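/- Let $n\ge 2$ and $4\le r\le\infty$ or $r=\omega$. Let $M$ be an $n$-dimensional $C^r$-manifold, $\bar x:M\to\mathbb R^{n+1}$ a $C^r$-immersion oriented by a continuous unit normal field $\bar\xi$ (the Euclidean normalization), and suppose that its Gaussian curvature $K_I=\det(h_{ij})/\det(g_{ij})$ vanishes nowhere, where, in local coordinates $u^1,\dots,u^n$, $g_{ij}=\langle\bar x_{/i},\bar x_{/j}\rangle$, $h_{ij}=\langle\bar\xi,\bar x_{/ij}\rangle$ and $/i$ denotes $\partial/\partial u^i$. A relative normalization is a map $\bar y:M\to\mathbb R^{n+1}$ of class $C^1$ (at least) such that everywhere $\operatorname{rank}(\bar x_{/1},\dots,\bar x_{/n},\bar y)=n+1$ and $\operatorname{rank}(\bar x_{/1},\dots,\bar x_{/n},\bar y_{/i})=n$ for $i=1,\dots,n$. For such $\bar y$ let $q=\langle\bar\xi,\bar y\rangle$ be its support function, let $\bar X$ be the covector with $\langle\bar X,\bar x_{/i}\rangle=0$, $\langle\bar X,\bar y\rangle=1$, let $G_{ij}=\langle\bar X,\bar x_{/ij}\rangle$ be the relative metric, with Levi-Civita connection $\nabla$, and let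 $S$ be the normalized scalar curvature of $G$ (the full scalar curvature $G^{jk}R_{jk}$ divided by $n(n-1)$). Let $H=\frac1n\operatorname{tr}(B_i^j)$, where $\bar y_{/i}=-B_i^j\bar x_{/j}$, and let $J=\frac1{n(n-1)}A_{jkl}A^{jkl}$, where $A_{jkl}=\langle\bar X,\nabla_l\nabla_k\bar x_{/j}\rangle$ and indices are raised with $G$. There is exactly one relative normalization $\bar y_{\rm aff}$, the equiaffine normalization, whose support function is $q_{\rm aff}=|K_I|^{1/(n+2)}$. Let $J_{\rm aff}$ be its invariant $J$. Then the function $$\frac{3(S-H)+(n-1)J}{q}$$ on $M$ is the same for all relative normalizations $\bar y$ of the hypersurface. It satisfies $$\frac{3(S-H)+(n-1)J}{q}=(n+2)\,\frac{J_{\rm aff}}{q_{\rm aff}},$$ so it vanishes at a point of $M$ if and only if $J_{\rm aff}$ vanishes there. -/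

import Mathlib

open scoped Manifold ContDiff

noncomputable section

namespace RelGeom

/-- `Coord n` is the coordinate space of the parameters `u = (u¹, …, uⁿ)`; the ambient Euclidean
space of a hypersurface of dimension `n` is `Coord (n + 1)`. -/
abbrev Coord (n : ℕ) : Type := EuclideanSpace ℝ (Fin n)

section Local

/-! ### Local notions

All objects here are functions of the coordinates `u`. The maps `x ξ y : Coord n → Coord (n + 1)`
are coordinate expressions of the position vector, of the Euclidean unit normal and of a
relative normalization. -/

variable {n : ℕ} {V : Type*} [NormedAddCommGroup V] [NormedSpace ℝ V]

/-- The partial derivative `∂f/∂uⁱ`. -/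
def pd (i : Fin n) (f : Coord n → V) (u : Coord n) : V :=
  fderiv ℝ f u (EuclideanSpace.single i (1 : ℝ))

/-- The first fundamental form `g_{ij} = ⟨x_{/i}, x_{/j}⟩`. -/
def firstForm (x : Coord n → Coord (n + 1)) (u : Coord n) : Matrix (Fin n) (Fin n) ℝ :=
  Matrix.of fun i j => inner ℝ (pd i x u) (pd j x u)

/-- The form `⟨N, x_{/ij}⟩`. For the Euclidean unit normal `N = ξ` this is the second fundamental
form `h_{ij}`, for the covector `N = X` of a relative normalization it is the relative metric
`G_{ij}`. -/
def hessForm (N x : Coord n → Coord (n + 1)) (u : Coord n) : Matrix (Fin n) (Fin n) ℝ :=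
  Matrix.of fun i j => inner ℝ (N u) (pd j (pd i x) u)

/-- The Gaussian curvature `K_I = det (h_{ij}) / det (g_{ij})`. -/
def gaussCurv (x ξ : Coord n → Coord (n + 1)) (u : Coord n) : ℝ :=
  (hessForm ξ x u).det / (firstForm x u).det

/-- The support function `q = ⟨ξ, y⟩`. -/
def support (ξ y : Coord n → Coord (n + 1)) (u : Coord n) : ℝ :=
  inner ℝ (ξ u) (y u)

/-- The support function `q_aff = |K_I|^{1/(n+2)}` of the equiaffine normalization. -/
def affSupport (x ξ : Coord n → Coord (n + 1)) (u : Coord n) : ℝ :=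
  |gaussCurv x ξ u| ^ ((1 : ℝ) / ((n : ℝ) + 2))

/-- The covector `X` of the relative normalization `y`: the vector normal to the hypersurface with
`⟨X, y⟩ = 1`, see `inner_conormal_pd`, `inner_conormal_self` and `eq_conormal`. -/
def conormal (ξ y : Coord n → Coord (n + 1)) (u : Coord n) : Coord (n + 1) :=
  (support ξ y u)⁻¹ • ξ u

/-- The relative metric `G_{ij} = ⟨X, x_{/ij}⟩`. -/
def relMetric (x ξ y : Coord n → Coord (n + 1)) : Coord n → Matrix (Fin n) (Fin n) ℝ :=
  hessForm (conormal ξ y) x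

/-- The Christoffel symbols `Γ^m_{ij}` of the (pseudo-Riemannian) metric `g`. -/
def christoffel (g : Coord n → Matrix (Fin n) (Fin n) ℝ) (m i j : Fin n) (u : Coord n) : ℝ :=
  (1 / 2) * ∑ l, (g u)⁻¹ m l *
    (pd i (fun v => g v j l) u + pd j (fun v => g v i l) u - pd l (fun v => g v i j) u)

/-- The Ricci tensor
`R_{jk} = ∂_i Γ^i_{jk} - ∂_j Γ^i_{ik} + Γ^i_{im} Γ^m_{jk} - Γ^i_{jm} Γ^m_{ik}`. -/
def ricci (g : Coord n → Matrix (Fin n) (Fin n) ℝ) (j k : Fin n) (u : Coord n) : ℝ :=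
  ∑ i, (pd i (christoffel g i j k) u - pd j (christoffel g i i k) u
    + ∑ m, (christoffel g i i m u * christoffel g m j k u
      - christoffel g i j m u * christoffel g m i k u))

/-- The normalized scalar curvature `g^{jk} R_{jk} / (n (n - 1))`; it is `1` on unit spheres and
the Gaussian curvature of `g` for `n = 2`. -/
def scalarCurv (g : Coord n → Matrix (Fin n) (Fin n) ℝ) (u : Coord n) : ℝ :=
  (1 / ((n : ℝ) * ((n : ℝ) - 1))) * ∑ j, ∑ k, (g u)⁻¹ j k * ricci g j k u

/-- The covariant derivative `∇_k w_j = ∂_k w_j - Γ^m_{kj} w_m` of a (vector-valued) covariant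
tensor of order one. -/
def covDerivOne (g : Coord n → Matrix (Fin n) (Fin n) ℝ) (w : Fin n → Coord n → V)
    (k j : Fin n) (u : Coord n) : V :=
  pd k (w j) u - ∑ m, christoffel g m k j u • w m u

/-- The covariant derivative `∇_l w_{kj} = ∂_l w_{kj} - Γ^m_{lk} w_{mj} - Γ^m_{lj} w_{km}` of a
(vector-valued) covariant tensor of order two. -/
def covDerivTwo (g : Coord n → Matrix (Fin n) (Fin n) ℝ) (w : Fin n → Fin n → Coord n → V)
    (l k j : Fin n) (u : Coord n) : V :=
  pd l (w k j) u - (∑ m, christoffel g m l k u • w m j u) - ∑ m, christoffel g m l j u • w k m u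

/-- The Darboux tensor `A_{jkl} = ⟨X, ∇_l ∇_k x_{/j}⟩`, with `∇` the covariant derivative of the
relative metric. -/
def darboux (x ξ y : Coord n → Coord (n + 1)) (j k l : Fin n) (u : Coord n) : ℝ :=
  inner ℝ (conormal ξ y u)
    (covDerivTwo (relMetric x ξ y) (covDerivOne (relMetric x ξ y) fun i => pd i x) l k j u)

/-- The Pick-invariant `J = A_{jkl} A^{jkl} / (n (n - 1))`, indices raised with the relative
metric. -/
def pick (x ξ y : Coord n → Coord (n + 1)) (u : Coord n) : ℝ :=
  (1 / ((n : ℝ) * ((n : ℝ) - 1))) * ∑ j, ∑ k, ∑ l, ∑ a, ∑ b, ∑ c,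
    (relMetric x ξ y u)⁻¹ j a * (relMetric x ξ y u)⁻¹ k b * (relMetric x ξ y u)⁻¹ l c *
      darboux x ξ y j k l u * darboux x ξ y a b c u

/-- The coefficients `B_i^j` of the relative shape operator, `y_{/i} = -B_i^j x_{/j}`,
see `pd_eq_shapeOp`. -/
def shapeOp (x y : Coord n → Coord (n + 1)) (u : Coord n) : Matrix (Fin n) (Fin n) ℝ :=
  Matrix.of fun i j => -∑ k, inner ℝ (pd i y u) (pd k x u) * (firstForm x u)⁻¹ k j

/-- The mean relative curvature `H = tr (B_i^j) / n`. -/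
def meanCurv (x y : Coord n → Coord (n + 1)) (u : Coord n) : ℝ :=
  (1 / (n : ℝ)) * (shapeOp x y u).trace

/-- The function `(3 (S - H) + (n - 1) J) / q` of the relative normalization `y`. -/
def relFun (x ξ y : Coord n → Coord (n + 1)) (u : Coord n) : ℝ :=
  (3 * (scalarCurv (relMetric x ξ y) u - meanCurv x y u) + ((n : ℝ) - 1) * pick x ξ y u)
    / support ξ y u

/-! ### The defining properties of the covector and of the shape operator -/

theorem inner_conormal_pd (x ξ y : Coord n → Coord (n + 1)) (u : Coord n) (i : Fin n)
    (h : inner ℝ (ξ u) (pd i x u) = 0) : inner ℝ (conormal ξ y u) (pd i x u) = 0 := by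
  simp [conormal, inner_smul_left, h]

theorem inner_conormal_self (ξ y : Coord n → Coord (n + 1)) (u : Coord n)
    (h : support ξ y u ≠ 0) : inner ℝ (conormal ξ y u) (y u) = 1 := by
  rw [conormal, real_inner_smul_left]
  exact inv_mul_cancel₀ h

theorem eq_conormal (x ξ y : Coord n → Coord (n + 1)) (u : Coord n)
    (hr : Submodule.span ℝ (insert (y u) (Set.range fun i => pd i x u)) = ⊤)
    (hn : ∀ i, inner ℝ (ξ u) (pd i x u) = 0) (hq : support ξ y u ≠ 0) (X : Coord (n + 1))
    (h₁ : ∀ i, inner ℝ X (pd i x u) = 0) (h₂ : inner ℝ X (y u) = 1) : X = conormal ξ y u := by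
  have key : ∀ v ∈ Submodule.span ℝ (insert (y u) (Set.range fun i => pd i x u)),
      inner ℝ (X - conormal ξ y u) v = 0 := by
    intro v hv
    induction hv using Submodule.span_induction with
    | mem v hv =>
      rcases hv with rfl | ⟨i, rfl⟩
      · rw [inner_sub_left, h₂, inner_conormal_self ξ y u hq, sub_self]
      · simp only [inner_sub_left, h₁ i, inner_conormal_pd x ξ y u i (hn i), sub_self]
    | zero => simp
    | add v w _ _ hv hw => rw [inner_add_right, hv, hw, add_zero]
    | smul c v _ hv => rw [inner_smul_right, hv, mul_zero]
  have := key (X - conormal ξ y u) (by rw [hr]; trivial)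
  exact sub_eq_zero.mp (inner_self_eq_zero.mp this)

theorem pd_eq_shapeOp (x y : Coord n → Coord (n + 1)) (u : Coord n)
    (hx : LinearIndependent ℝ fun i => pd i x u) (i : Fin n)
    (hy : pd i y u ∈ Submodule.span ℝ (Set.range fun j => pd j x u)) :
    pd i y u = -∑ j, shapeOp x y u i j • pd j x u := by
  obtain ⟨c, hc⟩ := (Submodule.mem_span_range_iff_exists_fun ℝ).1 hy
  have hg : firstForm x u = Matrix.gram ℝ fun i => pd i x u := rfl
  have hdet : IsUnit (firstForm x u).det := by
    rw [hg]
    exact (Matrix.posDef_gram_of_linearIndependent hx).det_pos.ne'.isUnit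
  have h1 : ∀ k, inner ℝ (pd i y u) (pd k x u) = Matrix.vecMul c (firstForm x u) k := by
    intro k
    rw [← hc, sum_inner]
    simp [Matrix.vecMul, dotProduct, firstForm, inner_smul_left]
  have h2 : ∀ j, shapeOp x y u i j = -c j := by
    intro j
    have : ∑ k, inner ℝ (pd i y u) (pd k x u) * (firstForm x u)⁻¹ k j
        = Matrix.vecMul (Matrix.vecMul c (firstForm x u)) (firstForm x u)⁻¹ j := by
      simp only [h1]
      rfl
    rw [Matrix.vecMul_vecMul, Matrix.mul_nonsing_inv _ hdet, Matrix.vecMul_one] at this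
    simp only [shapeOp, Matrix.of_apply, this]
  simp only [h2, neg_smul, Finset.sum_neg_distrib, neg_neg]
  exact hc.symm

end Local

section Global

/-! ### Hypersurfaces and their normalizations -/

variable {n : ℕ} {M : Type*} [TopologicalSpace M] [ChartedSpace (Coord n) M]

/-- `x : M → ℝⁿ⁺¹` is an immersion of class `C^r` of the `n`-dimensional manifold `M`, oriented by
the Euclidean normalization (unit normal field) `ξ`, with nowhere vanishing Gaussian curvature. -/
structure IsHypersurface (r : WithTop ℕ∞) (x ξ : M → Coord (n + 1)) : Prop where
  contMDiff : ContMDiff (𝓡 n) 𝓘(ℝ, Coord (n + 1)) r x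
  immersion : ∀ e ∈ IsManifold.maximalAtlas (𝓡 n) r M, ∀ u ∈ e.target,
    LinearIndependent ℝ fun i => pd i (x ∘ e.symm) u
  continuous_normal : Continuous ξ
  norm_normal : ∀ p, ‖ξ p‖ = 1
  normal : ∀ e ∈ IsManifold.maximalAtlas (𝓡 n) r M, ∀ u ∈ e.target, ∀ i,
    inner ℝ (ξ (e.symm u)) (pd i (x ∘ e.symm) u) = 0
  gaussCurv_ne_zero : ∀ e ∈ IsManifold.maximalAtlas (𝓡 n) r M, ∀ u ∈ e.target,
    gaussCurv (x ∘ e.symm) (ξ ∘ e.symm) u ≠ 0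

/-- `y` is a relative normalization of the `C^r`-hypersurface `x`: it is of class `C¹`, and in all
coordinates the vectors `x_{/1}, …, x_{/n}, y` have rank `n + 1` and the vectors
`x_{/1}, …, x_{/n}, y_{/i}` have rank `n` for every `i`. -/
structure IsRelNormalization (r : WithTop ℕ∞) (x y : M → Coord (n + 1)) : Prop where
  contMDiff : ContMDiff (𝓡 n) 𝓘(ℝ, Coord (n + 1)) 1 y
  rank_self : ∀ e ∈ IsManifold.maximalAtlas (𝓡 n) r M, ∀ u ∈ e.target,
    Set.finrank ℝ (insert (y (e.symm u)) (Set.range fun i => pd i (x ∘ e.symm) u)) = n + 1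
  rank_pd : ∀ e ∈ IsManifold.maximalAtlas (𝓡 n) r M, ∀ u ∈ e.target, ∀ i,
    Set.finrank ℝ (insert (pd i (y ∘ e.symm) u) (Set.range fun j => pd j (x ∘ e.symm) u)) = n

/-- `y` is the equiaffine normalization: the relative normalization with support function
`q_aff = |K_I|^{1/(n+2)}`. -/
structure IsEquiaffine (r : WithTop ℕ∞) (x ξ y : M → Coord (n + 1)) : Prop where
  isRelNormalization : IsRelNormalization r x y
  support_eq : ∀ e ∈ IsManifold.maximalAtlas (𝓡 n) r M, ∀ u ∈ e.target,
    support (ξ ∘ e.symm) (y ∘ e.symm) u = affSupport (x ∘ e.symm) (ξ ∘ e.symm) u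

end Global

end RelGeom

end

/-!
The cubic form of a relative normalization carries the whole invariant. Write `q` for the support
function of `y`, `G = h / q` for its metric, `A` for its Darboux tensor and `T_j = G^{kl} A_{jkl}`
for the trace of `A`.

*Theorema egregium.* The normalization `y` induces a torsion-free connection `Λ = Γ + A` by the
Gauss equation `x_{/jk} = Λ^m_{kj} x_{/m} + G_{jk} y`, and the integrability conditions of this
equation give the curvature of `Λ` in terms of `G` and of the shape operator `B`
(`IsLocalNormalization.connCurv_inducedConn`). The connection `Γ - A` is dual to `Λ` with respect
to `G`, so its curvature is minus the adjoint of that of `Λ` (`IsMetricOn.connCurv_dual`), and the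
mean of the two curvatures is the Riemannian curvature of `G` plus the commutator `[A, A]`. Taking
traces yields `n (n - 1) (S - H) = |A|² - |T|²` (`IsLocalNormalization.sum_inv_mul_ricci`). No
covariant derivative of `A` enters in this way. Hence `3 (S - H) + (n - 1) J` is a constant
multiple of `(n + 2) |A|² - 3 |T|²` (`IsLocalNormalization.relFun_eq`), which up to the factor
`n + 2` is the squared norm of the traceless part of `A`.

*Change of normalization.* In ordinary partial derivatives `A` is
`⟨X, x_{/jkl}⟩ - (G_{jk/l} + G_{kl/j} + G_{jl/k}) / 2` with `X = ξ / q` (`IsLocalNormalization.darboux_eq`). Therefore `q A` is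
a cubic form of the Euclidean normalization plus the symmetrized product of `d log q` and `h`
(`IsLocalNormalization.darboux_eq_normalCubic`). The product has no traceless part, so the
traceless part of `q A` is independent of `y`, and the squared norm of that of `A`, taken with
`G`, is `q` times a quantity independent of `y`.

*The equiaffine normalization.* By the Weingarten equation and Jacobi's formula the trace of the
Euclidean cubic form is `-d log |K_I| / 2` (`cubicTrace_normalCubic`, `pd_affSupport`), so `A` is
traceless for `q = |K_I|^{1/(n+2)}` (`cubicTrace_equiaffine`), and for this `q` the invariant is
`(n + 2) J_aff / q_aff`.

*Existence and uniqueness.* The equations `⟨ξ, y⟩ = q` and `⟨ξ_{/i}, y⟩ = q_{/i}` determine `y`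
from `q`, since `ξ, ξ_{/1}, …, ξ_{/n}` is a basis where `K_I ≠ 0`; they are solved by
`normalizationOf`. Their invariance under changes of coordinates glues the local solutions.
-/

noncomputable section

namespace RelGeom

/-! ### Calculus of partial derivatives -/

section Calculus

variable {n : ℕ} {V : Type*} [NormedAddCommGroup V] [NormedSpace ℝ V] {U : Set (Coord n)}
  {u : Coord n}

theorem pd_congr (hU : IsOpen U) {f g : Coord n → V} (h : ∀ v ∈ U, f v = g v) (hu : u ∈ U)
    (i : Fin n) : pd i f u = pd i g u := by
  have : f =ᶠ[nhds u] g := Filter.eventuallyEq_of_mem (hU.mem_nhds hu) h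
  rw [pd, pd, this.fderiv_eq]

theorem pd_const (c : V) (i : Fin n) : pd i (fun _ : Coord n => c) u = 0 := by
  simp [pd]

theorem pd_add {f g : Coord n → V} (hf : DifferentiableAt ℝ f u) (hg : DifferentiableAt ℝ g u)
    (i : Fin n) : pd i (fun v => f v + g v) u = pd i f u + pd i g u := by
  simp [pd, fderiv_fun_add hf hg]

theorem pd_sub {f g : Coord n → V} (hf : DifferentiableAt ℝ f u) (hg : DifferentiableAt ℝ g u)
    (i : Fin n) : pd i (fun v => f v - g v) u = pd i f u - pd i g u := by
  simp [pd, fderiv_fun_sub hf hg]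

theorem pd_sum {ι : Type*} {s : Finset ι} {f : ι → Coord n → V}
    (hf : ∀ a ∈ s, DifferentiableAt ℝ (f a) u) (i : Fin n) :
    pd i (fun v => ∑ a ∈ s, f a v) u = ∑ a ∈ s, pd i (f a) u := by
  simp [pd, fderiv_fun_sum hf]

theorem pd_smul {c : Coord n → ℝ} {f : Coord n → V} (hc : DifferentiableAt ℝ c u)
    (hf : DifferentiableAt ℝ f u) (i : Fin n) :
    pd i (fun v => c v • f v) u = pd i c u • f u + c u • pd i f u := by
  simp [pd, fderiv_fun_smul hc hf, add_comm]

theorem pd_mul {c f : Coord n → ℝ} (hc : DifferentiableAt ℝ c u)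
    (hf : DifferentiableAt ℝ f u) (i : Fin n) :
    pd i (fun v => c v * f v) u = pd i c u * f u + c u * pd i f u :=
  pd_smul hc hf i

theorem pd_inner {m : ℕ} {f g : Coord n → Coord m} (hf : DifferentiableAt ℝ f u)
    (hg : DifferentiableAt ℝ g u) (i : Fin n) :
    pd i (fun v => (inner ℝ (f v) (g v) : ℝ)) u
      = inner ℝ (pd i f u) (g u) + inner ℝ (f u) (pd i g u) := by
  rw [pd, fderiv_inner_apply ℝ hf hg, add_comm]; rfl

theorem contDiffOn_pd {k l : WithTop ℕ∞} {f : Coord n → V} (hf : ContDiffOn ℝ k f U)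
    (hU : IsOpen U) (hl : l + 1 ≤ k) (i : Fin n) : ContDiffOn ℝ l (pd i f) U :=
  (hf.fderiv_of_isOpen hU hl).clm_apply contDiffOn_const

theorem differentiableAt_of_contDiffOn {k : WithTop ℕ∞} {f : Coord n → V}
    (hf : ContDiffOn ℝ k f U) (hU : IsOpen U) (hu : u ∈ U) (hk : k ≠ 0) :
    DifferentiableAt ℝ f u :=
  (hf.contDiffAt (hU.mem_nhds hu)).differentiableAt hk

theorem pd_comm {f : Coord n → V} (hf : ContDiffOn ℝ 2 f U) (hU : IsOpen U) (hu : u ∈ U)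
    (i j : Fin n) : pd i (pd j f) u = pd j (pd i f) u := by
  have hf' := hf.contDiffAt (hU.mem_nhds hu)
  have hd : DifferentiableAt ℝ (fderiv ℝ f) u :=
    (hf'.fderiv_right (m := 1) (by norm_num)).differentiableAt one_ne_zero
  have key : ∀ a b : Fin n, pd a (pd b f) u
      = fderiv ℝ (fderiv ℝ f) u (EuclideanSpace.single a 1) (EuclideanSpace.single b 1) := by
    intro a b
    change fderiv ℝ (fun v => fderiv ℝ f v (EuclideanSpace.single b (1 : ℝ))) u _ = _
    rw [fderiv_clm_apply hd (by fun_prop)]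
    simp
  rw [key, key]
  exact (hf'.isSymmSndFDerivAt (by simp)).eq _ _

end Calculus

/-! ### Differentiating determinants and inverse matrices -/

section Det

variable {n k : ℕ} {U : Set (Coord n)} {u : Coord n}

/-- The determinant as a continuous multilinear function of the rows. -/
def detMultilinear (k : ℕ) :
    ContinuousMultilinearMap ℝ (fun _ : Fin k => Fin k → ℝ) ℝ where
  toMultilinearMap := (Matrix.detRowAlternating (R := ℝ) (n := Fin k)).toMultilinearMap
  cont := Continuous.matrix_det (A := fun m : Fin k → Fin k → ℝ => (m : Matrix (Fin k) (Fin k) ℝ))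
    continuous_id

theorem contDiffOn_det {r : WithTop ℕ∞} {A : Coord n → Matrix (Fin k) (Fin k) ℝ}
    (hA : ∀ i j, ContDiffOn ℝ r (fun v => A v i j) U) :
    ContDiffOn ℝ r (fun v => (A v).det) U := by
  have h1 : ContDiffOn ℝ r (fun v => (fun i j => A v i j : Fin k → Fin k → ℝ)) U :=
    contDiffOn_pi.2 fun i => contDiffOn_pi.2 fun j => hA i j
  exact (detMultilinear k).contDiff.comp_contDiffOn h1

theorem contDiffOn_inv {r : WithTop ℕ∞} {A : Coord n → Matrix (Fin k) (Fin k) ℝ}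
    (hA : ∀ i j, ContDiffOn ℝ r (fun v => A v i j) U) (hd : ∀ v ∈ U, (A v).det ≠ 0)
    (i j : Fin k) : ContDiffOn ℝ r (fun v => (A v)⁻¹ i j) U := by
  have h1 : ContDiffOn ℝ r (fun v => ((A v).updateRow j (Pi.single i 1)).det) U := by
    refine contDiffOn_det fun a b => ?_
    by_cases h : a = j
    · subst h
      simpa using contDiffOn_const
    · simpa [Matrix.updateRow_ne h] using hA a b
  refine ((contDiffOn_det hA).inv hd |>.mul h1).congr fun v _ => ?_
  rw [Matrix.inv_def, Ring.inverse_eq_inv', Matrix.smul_apply, Matrix.adjugate_apply, smul_eq_mul]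
  rfl

/-- Jacobi's formula. -/
theorem pd_det {A : Coord n → Matrix (Fin k) (Fin k) ℝ}
    (hA : ∀ i j, DifferentiableAt ℝ (fun v => A v i j) u) (hd : (A u).det ≠ 0) (i : Fin n) :
    pd i (fun v => (A v).det) u
      = (A u).det * ∑ a, ∑ b, (A u)⁻¹ a b * pd i (fun v => A v b a) u := by
  have h1 : HasFDerivAt (fun v => (fun i j => A v i j : Fin k → Fin k → ℝ))
      (ContinuousLinearMap.pi fun i => ContinuousLinearMap.pi fun j =>
        fderiv ℝ (fun v => A v i j) u) u :=
    hasFDerivAt_pi.2 fun i => hasFDerivAt_pi.2 fun j => (hA i j).hasFDerivAt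
  have h2 : HasFDerivAt (fun v => (A v).det) _ u :=
    HasFDerivAt.comp (g := detMultilinear k)
      (f := fun v => (fun i j => A v i j : Fin k → Fin k → ℝ)) u
      ((detMultilinear k).hasFDerivAt _) h1
  have h3 : ∀ b : Fin k, ∀ w : Fin k → ℝ, ((A u).updateRow b w).det
      = (A u).det * ∑ a, (A u)⁻¹ a b * w a := by
    intro b w
    rw [← Matrix.cramer_transpose_apply, Matrix.cramer_eq_adjugate_mulVec, Matrix.inv_def,
      Ring.inverse_eq_inv', Finset.mul_sum, Matrix.mulVec, dotProduct]
    refine Finset.sum_congr rfl fun a _ => ?_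
    rw [Matrix.smul_apply, smul_eq_mul, ← Matrix.adjugate_transpose, Matrix.transpose_apply]
    field_simp
  rw [pd, h2.fderiv, Finset.sum_comm, Finset.mul_sum]
  simp only [ContinuousLinearMap.comp_apply, ContinuousMultilinearMap.linearDeriv_apply]
  refine Finset.sum_congr rfl fun b _ => ?_
  exact h3 b _

end Det

/-! ### The Levi-Civita connection -/

section LeviCivita

variable {n : ℕ} {U : Set (Coord n)} {u : Coord n} {g : Coord n → Matrix (Fin n) (Fin n) ℝ}

theorem sum_mul_sum_inv {A : Matrix (Fin n) (Fin n) ℝ} (hA : A.det ≠ 0) (X : Fin n → ℝ)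
    (p : Fin n) : ∑ m, A p m * ∑ l, A⁻¹ m l * X l = X p := by
  change (A.mulVec (A⁻¹.mulVec X)) p = X p
  rw [Matrix.mulVec_mulVec, Matrix.mul_nonsing_inv _ hA.isUnit, Matrix.one_mulVec]

theorem sum_inv_mul_sum {A : Matrix (Fin n) (Fin n) ℝ} (hA : A.det ≠ 0) (X : Fin n → ℝ)
    (p : Fin n) : ∑ m, A⁻¹ p m * ∑ l, A m l * X l = X p := by
  change (A⁻¹.mulVec (A.mulVec X)) p = X p
  rw [Matrix.mulVec_mulVec, Matrix.nonsing_inv_mul _ hA.isUnit, Matrix.one_mulVec]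

theorem sum_inv_mul {A : Matrix (Fin n) (Fin n) ℝ} (hA : A.det ≠ 0) (p q : Fin n) :
    ∑ m, A⁻¹ p m * A m q = if p = q then 1 else 0 := by
  rw [← Matrix.mul_apply, Matrix.nonsing_inv_mul _ hA.isUnit, Matrix.one_apply]

theorem inv_symm {A : Matrix (Fin n) (Fin n) ℝ} (hA : ∀ i j, A i j = A j i) (i j : Fin n) :
    A⁻¹ i j = A⁻¹ j i := by
  have : A.transpose = A := Matrix.ext fun a b => hA b a
  rw [← Matrix.transpose_apply A⁻¹, Matrix.transpose_nonsing_inv, this]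

/-- A nondegenerate symmetric metric of class `C²` on an open set of coordinates. -/
structure IsMetricOn (g : Coord n → Matrix (Fin n) (Fin n) ℝ) (U : Set (Coord n)) : Prop where
  isOpen : IsOpen U
  contDiffOn : ∀ i j, ContDiffOn ℝ 2 (fun v => g v i j) U
  symm : ∀ v ∈ U, ∀ i j, g v i j = g v j i
  det_ne_zero : ∀ v ∈ U, (g v).det ≠ 0

namespace IsMetricOn

theorem pd_symm (h : IsMetricOn g U) (hu : u ∈ U) (l i j : Fin n) :
    pd l (fun v => g v i j) u = pd l (fun v => g v j i) u :=
  pd_congr h.isOpen (fun v hv => h.symm v hv i j) hu l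

theorem sum_mul_christoffel (h : IsMetricOn g U) (hu : u ∈ U) (p i j : Fin n) :
    ∑ m, g u p m * christoffel g m i j u = (1 / 2) * (pd i (fun v => g v j p) u
      + pd j (fun v => g v i p) u - pd p (fun v => g v i j) u) := by
  have := sum_mul_sum_inv (h.det_ne_zero u hu) (fun l => pd i (fun v => g v j l) u
      + pd j (fun v => g v i l) u - pd l (fun v => g v i j) u) p
  rw [← this, Finset.mul_sum]
  refine Finset.sum_congr rfl fun m _ => ?_
  simp only [christoffel]
  ring

theorem pd_eq_christoffel (h : IsMetricOn g U) (hu : u ∈ U) (k i j : Fin n) :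
    pd k (fun v => g v i j) u
      = ∑ m, (christoffel g m k i u * g u m j + g u i m * christoffel g m k j u) := by
  have h1 := h.sum_mul_christoffel hu j k i
  have h2 := h.sum_mul_christoffel hu i k j
  rw [Finset.sum_add_distrib, h2]
  have h3 : ∑ m, christoffel g m k i u * g u m j = ∑ m, g u j m * christoffel g m k i u :=
    Finset.sum_congr rfl fun m _ => by rw [h.symm u hu j m, mul_comm]
  rw [h3, h1, h.pd_symm hu k j i, h.pd_symm hu j k i, h.pd_symm hu i k j]
  ring

theorem contDiffOn_inv (h : IsMetricOn g U) (i j : Fin n) :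
    ContDiffOn ℝ 2 (fun v => (g v)⁻¹ i j) U :=
  RelGeom.contDiffOn_inv h.contDiffOn h.det_ne_zero i j

theorem contDiffOn_christoffel (h : IsMetricOn g U) (m i j : Fin n) :
    ContDiffOn ℝ 1 (christoffel g m i j) U := by
  have hp : ∀ k i j, ContDiffOn ℝ 1 (pd k (fun v => g v i j)) U := fun k i j =>
    contDiffOn_pd (h.contDiffOn i j) h.isOpen (by norm_num) k
  refine contDiffOn_const.mul (ContDiffOn.sum fun l _ => ?_)
  exact ((h.contDiffOn_inv m l).of_le (by norm_num)).mul (((hp i j l).add (hp j i l)).sub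
    (hp l i j))

end IsMetricOn

end LeviCivita

/-! ### Curvature of a connection and of its dual -/

section Curvature

variable {n : ℕ} {U : Set (Coord n)} {u : Coord n} {g : Coord n → Matrix (Fin n) (Fin n) ℝ}

/-- The curvature tensor `R_{kl}{}^m{}_j` of the connection with coefficients `Λ^m_{kj}`
(written `Λ m k j`). -/
def connCurv (Λ : Fin n → Fin n → Fin n → Coord n → ℝ) (k l m j : Fin n) (u : Coord n) : ℝ :=
  pd k (Λ m l j) u - pd l (Λ m k j) u
    + ∑ p, (Λ m k p u * Λ p l j u - Λ m l p u * Λ p k j u)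

theorem ricci_eq_sum_connCurv (j k : Fin n) :
    ricci g j k u = ∑ i, connCurv (christoffel g) i j i k u := rfl

/-- If two connections are dual with respect to `g`, then their curvature tensors are, up to sign,
adjoint to each other. This follows from the symmetry of the second derivatives of `g`. -/
theorem IsMetricOn.connCurv_dual (h : IsMetricOn g U)
    {Λ Λ' : Fin n → Fin n → Fin n → Coord n → ℝ}
    (hΛ : ∀ m k j, ContDiffOn ℝ 1 (Λ m k j) U) (hΛ' : ∀ m k j, ContDiffOn ℝ 1 (Λ' m k j) U)
    (hd : ∀ v ∈ U, ∀ k i j, pd k (fun v => g v i j) v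
      = ∑ m, (Λ m k i v * g v m j + g v i m * Λ' m k j v))
    (hu : u ∈ U) (k l i j : Fin n) :
    ∑ m, (connCurv Λ k l m i u * g u m j + g u i m * connCurv Λ' k l m j u) = 0 := by
  let L : Fin n → Matrix (Fin n) (Fin n) ℝ := fun k => Matrix.of fun m j => Λ m k j u
  let L' : Fin n → Matrix (Fin n) (Fin n) ℝ := fun k => Matrix.of fun m j => Λ' m k j u
  let D : Fin n → Fin n → Matrix (Fin n) (Fin n) ℝ := fun k l =>
    Matrix.of fun m j => pd k (Λ m l j) u
  let D' : Fin n → Fin n → Matrix (Fin n) (Fin n) ℝ := fun k l =>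
    Matrix.of fun m j => pd k (Λ' m l j) u
  let dG : Fin n → Matrix (Fin n) (Fin n) ℝ := fun k => Matrix.of fun i j =>
    pd k (fun v => g v i j) u
  let ddG : Fin n → Fin n → Matrix (Fin n) (Fin n) ℝ := fun k l => Matrix.of fun i j =>
    pd k (pd l (fun v => g v i j)) u
  have dG_eq : ∀ k, dG k = (L k).transpose * g u + g u * L' k := by
    intro k
    ext i j
    simp only [dG, Matrix.of_apply, hd u hu, Matrix.add_apply, Matrix.mul_apply,
      Matrix.transpose_apply, L, L', Finset.sum_add_distrib]
  have ddG_eq : ∀ k l, ddG k l = (D k l).transpose * g u + (L l).transpose * dG k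
      + dG k * L' l + g u * D' k l := by
    intro k l
    ext i j
    have dg : ∀ a b, DifferentiableAt ℝ (fun v => g v a b) u := fun a b =>
      differentiableAt_of_contDiffOn (h.contDiffOn a b) h.isOpen hu (by norm_num)
    have dL : ∀ a b c, DifferentiableAt ℝ (Λ a b c) u := fun a b c =>
      differentiableAt_of_contDiffOn (hΛ a b c) h.isOpen hu (by norm_num)
    have dL' : ∀ a b c, DifferentiableAt ℝ (Λ' a b c) u := fun a b c =>
      differentiableAt_of_contDiffOn (hΛ' a b c) h.isOpen hu (by norm_num)
    simp only [ddG, Matrix.of_apply, Matrix.add_apply, Matrix.mul_apply,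
      Matrix.transpose_apply, L, L', D, D', dG]
    rw [pd_congr h.isOpen (fun v hv => hd v hv l i j) hu,
      pd_sum fun m _ => ((dL m l i).fun_mul (dg m j)).fun_add ((dg i m).fun_mul (dL' m l j)),
      ← Finset.sum_add_distrib, ← Finset.sum_add_distrib, ← Finset.sum_add_distrib]
    refine Finset.sum_congr rfl fun m _ => ?_
    rw [pd_add ((dL m l i).fun_mul (dg m j)) ((dg i m).fun_mul (dL' m l j)),
      pd_mul (dL m l i) (dg m j), pd_mul (dg i m) (dL' m l j)]
    ring
  have hsymm : ddG k l = ddG l k := by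
    ext i j
    exact pd_comm (h.contDiffOn i j) h.isOpen hu k l
  have key : (D k l - D l k + (L k * L l - L l * L k)).transpose * g u
      + g u * (D' k l - D' l k + (L' k * L' l - L' l * L' k)) = 0 := by
    rw [ddG_eq, ddG_eq, dG_eq, dG_eq, ← sub_eq_zero] at hsymm
    rw [← hsymm]
    simp only [Matrix.transpose_add, Matrix.transpose_sub, Matrix.transpose_mul]
    noncomm_ring
  have := congrFun (congrFun key i) j
  simp only [Matrix.add_apply, Matrix.mul_apply, Matrix.transpose_apply, Matrix.sub_apply,
    Matrix.zero_apply, L, L', D, D', Matrix.of_apply, ← Finset.sum_sub_distrib,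
    ← Finset.sum_add_distrib] at this
  exact this

/-- The curvature of a connection is half the sum of the curvatures of its two translates by
`± a`, up to the commutator of `a`. -/
theorem connCurv_add_add_connCurv_sub {Γ a : Fin n → Fin n → Fin n → Coord n → ℝ}
    (hΓ : ∀ m k j, DifferentiableAt ℝ (Γ m k j) u) (ha : ∀ m k j, DifferentiableAt ℝ (a m k j) u)
    (k l m j : Fin n) :
    connCurv (fun m k j v => Γ m k j v + a m k j v) k l m j u
      + connCurv (fun m k j v => Γ m k j v - a m k j v) k l m j u
      = 2 * connCurv Γ k l m j u
        + 2 * ∑ p, (a m k p u * a p l j u - a m l p u * a p k j u) := by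
  simp only [connCurv, pd_add (hΓ _ _ _) (ha _ _ _), pd_sub (hΓ _ _ _) (ha _ _ _)]
  have : ∑ p, ((Γ m k p u + a m k p u) * (Γ p l j u + a p l j u)
        - (Γ m l p u + a m l p u) * (Γ p k j u + a p k j u))
      + ∑ p, ((Γ m k p u - a m k p u) * (Γ p l j u - a p l j u)
        - (Γ m l p u - a m l p u) * (Γ p k j u - a p k j u))
      = 2 * ∑ p, (Γ m k p u * Γ p l j u - Γ m l p u * Γ p k j u)
        + 2 * ∑ p, (a m k p u * a p l j u - a m l p u * a p k j u) := by
    simp only [Finset.mul_sum, ← Finset.sum_add_distrib]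
    exact Finset.sum_congr rfl fun p _ => by ring
  linear_combination this

end Curvature

/-! ### Cubic forms -/

section Cubic

variable {n : ℕ}

/-- The full contraction `A_{jkl} C^{jkl}` of two covariant tensors of order three, `Q` being the
inverse of the metric. -/
def cubicInner (Q : Matrix (Fin n) (Fin n) ℝ) (A C : Fin n → Fin n → Fin n → ℝ) : ℝ :=
  ∑ j, ∑ k, ∑ l, ∑ a, ∑ b, ∑ c, Q j a * Q k b * Q l c * A j k l * C a b c

/-- The trace `A_{jkl} Q^{kl}` of a covariant tensor of order three, `Q` being the inverse of the
metric. -/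
def cubicTrace (Q : Matrix (Fin n) (Fin n) ℝ) (A : Fin n → Fin n → Fin n → ℝ) (j : Fin n) : ℝ :=
  ∑ k, ∑ l, Q k l * A j k l

/-- Total symmetry of a covariant tensor of order three. -/
def IsCubicForm (A : Fin n → Fin n → Fin n → ℝ) : Prop :=
  (∀ i j k, A i j k = A j i k) ∧ ∀ i j k, A i j k = A i k j

/-- The trace of the commutator `[A_i, A_j]` of the endomorphisms defined by a cubic form. -/
theorem IsCubicForm.sum_commutator {A : Fin n → Fin n → Fin n → ℝ} (hA : IsCubicForm A)
    {Q : Matrix (Fin n) (Fin n) ℝ} (hQ : ∀ i j, Q i j = Q j i) :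
    ∑ j, ∑ k, Q j k * ∑ i, ∑ p,
        ((∑ q, Q i q * A q i p) * (∑ r, Q p r * A r j k)
          - (∑ q, Q i q * A q j p) * (∑ r, Q p r * A r i k))
      = (∑ j, ∑ k, Q j k * (cubicTrace Q A j * cubicTrace Q A k)) - cubicInner Q A A := by
  have h1 : ∀ p, ∑ i, ∑ q, Q i q * A q i p = cubicTrace Q A p := by
    intro p
    refine Finset.sum_congr rfl fun i _ => Finset.sum_congr rfl fun q _ => ?_
    rw [hA.1 q i p, hA.2 i q p, hA.1 i p q, hA.2 p i q, hA.2 p q i]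
  have h2 : ∀ j k, ∑ i, ∑ p, (∑ q, Q i q * A q i p) * (∑ r, Q p r * A r j k)
      = ∑ p, ∑ r, cubicTrace Q A p * (Q p r * A r j k) := by
    intro j k
    rw [Finset.sum_comm]
    refine Finset.sum_congr rfl fun p _ => ?_
    rw [← Finset.sum_mul, h1, Finset.mul_sum]
  simp only [Finset.sum_sub_distrib, mul_sub, h2]
  congr 1
  · simp only [cubicTrace, Finset.mul_sum, Finset.sum_mul]
    simp only [← Fintype.sum_prod_type']
    refine Finset.sum_nbij' (fun ⟨j, k, p, r, a, b⟩ => (p, r, j, k, a, b))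
      (fun ⟨p, r, j, k, a, b⟩ => (j, k, p, r, a, b)) (by simp) (by simp) (fun _ _ => rfl)
      (fun _ _ => rfl) fun x _ => ?_
    ring
  · simp only [cubicInner, Finset.mul_sum, Finset.sum_mul]
    simp only [← Fintype.sum_prod_type']
    refine Finset.sum_nbij' (fun ⟨j, k, i, p, r, q⟩ => (q, j, p, i, k, r))
      (fun ⟨q, j, p, i, k, r⟩ => (j, k, i, p, r, q)) (by simp) (by simp) (fun _ _ => rfl)
      (fun _ _ => rfl) ?_
    rintro ⟨j, k, i, p, r, q⟩ -
    dsimp only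
    rw [hQ q i, hA.2 i k r, hA.1 i r k]
    ring

end Cubic

/-! ### The theorema egregium -/

section Egregium

variable {n : ℕ} {U : Set (Coord n)} {u : Coord n} {g : Coord n → Matrix (Fin n) (Fin n) ℝ}

/-- The endomorphism-valued form `A^m_{kj}` obtained by raising the first index of `A`. -/
def raise (g : Coord n → Matrix (Fin n) (Fin n) ℝ) (A : Fin n → Fin n → Fin n → Coord n → ℝ)
    (m k j : Fin n) (u : Coord n) : ℝ :=
  ∑ p, (g u)⁻¹ m p * A p k j u

theorem sum_mul_raise (h : IsMetricOn g U) (hu : u ∈ U)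
    (A : Fin n → Fin n → Fin n → Coord n → ℝ) (p k j : Fin n) :
    ∑ m, g u p m * raise g A m k j u = A p k j u :=
  sum_mul_sum_inv (h.det_ne_zero u hu) (fun q => A q k j u) p

/-- The theorema egregium in terms of the cubic form `A`: if the connection `Γ + A` has the
curvature `B_k^m g_{jl} - B_l^m g_{jk}` of a hypersurface with shape operator `B`, then the scalar
curvature of `g` is `(n - 1) tr B + |A|² - |tr A|²`. The dual connection `Γ - A` has curvature
minus the adjoint of this, and the mean of the two curvatures is that of `g` plus a commutator. -/
theorem IsMetricOn.sum_inv_mul_ricci (h : IsMetricOn g U)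
    {A : Fin n → Fin n → Fin n → Coord n → ℝ} (hA : ∀ i j k, ContDiffOn ℝ 1 (A i j k) U)
    (hsymm : ∀ v ∈ U, IsCubicForm fun i j k => A i j k v) (B : Matrix (Fin n) (Fin n) ℝ)
    (hu : u ∈ U)
    (hflat : ∀ k l m j,
      connCurv (fun m k j v => christoffel g m k j v + raise g A m k j v) k l m j u
      = B k m * g u j l - B l m * g u j k) :
    ∑ j, ∑ k, (g u)⁻¹ j k * ricci g j k u
      = ((n : ℝ) - 1) * B.trace
        + cubicInner (g u)⁻¹ (fun i j k => A i j k u) (fun i j k => A i j k u)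
        - ∑ j, ∑ k, (g u)⁻¹ j k * (cubicTrace (g u)⁻¹ (fun i j k => A i j k u) j
            * cubicTrace (g u)⁻¹ (fun i j k => A i j k u) k) := by
  have hdet := h.det_ne_zero u hu
  have gs := h.symm u hu
  have hr : ∀ m k j, ContDiffOn ℝ 1 (raise g A m k j) U := fun m k j =>
    ContDiffOn.sum fun p _ => ((h.contDiffOn_inv m p).of_le (by norm_num)).mul (hA p k j)
  have hdual := fun k l i j => h.connCurv_dual
    (Λ := fun m k j v => christoffel g m k j v + raise g A m k j v)
    (Λ' := fun m k j v => christoffel g m k j v - raise g A m k j v)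
    (fun m k j => (h.contDiffOn_christoffel m k j).add (hr m k j))
    (fun m k j => (h.contDiffOn_christoffel m k j).sub (hr m k j))
    (fun v hv k i j => by
      rw [h.pd_eq_christoffel hv]
      have h1 := sum_mul_raise h hv A j k i
      have h2 := sum_mul_raise h hv A i k j
      have h3 : ∑ m, raise g A m k i v * g v m j = ∑ m, g v i m * raise g A m k j v := by
        rw [h2, show A i k j v = A j k i v from (((hsymm v hv).1 i k j).trans
            ((hsymm v hv).2 k i j)).trans ((hsymm v hv).1 k j i), ← h1]
        exact Finset.sum_congr rfl fun m _ => by rw [h.symm v hv j m, mul_comm]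
      simp only [add_mul, mul_sub, Finset.sum_add_distrib, Finset.sum_sub_distrib]
      linear_combination -h3)
    hu k l i j
  -- the curvature of the dual connection
  have hdual' : ∀ k l m j, connCurv (fun m k j v => christoffel g m k j v - raise g A m k j v)
      k l m j u = (if m = k then 1 else 0) * (∑ p, B l p * g u p j)
        - (if m = l then 1 else 0) * ∑ p, B k p * g u p j := by
    intro k l m j
    rw [← sum_inv_mul_sum hdet (fun m => connCurv
      (fun m k j v => christoffel g m k j v - raise g A m k j v) k l m j u) m]
    have h1 : ∀ i, ∑ q, g u i q * connCurv
        (fun m k j v => christoffel g m k j v - raise g A m k j v) k l q j u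
        = g u i k * (∑ p, B l p * g u p j) - g u i l * ∑ p, B k p * g u p j := by
      intro i
      have := hdual k l i j
      simp only [hflat, Finset.sum_add_distrib] at this
      rw [eq_neg_of_add_eq_zero_right this, Finset.mul_sum, Finset.mul_sum,
        ← Finset.sum_sub_distrib, ← Finset.sum_neg_distrib]
      exact Finset.sum_congr rfl fun p _ => by ring
    simp only [h1, mul_sub, ← mul_assoc, Finset.sum_sub_distrib, ← Finset.sum_mul,
      sum_inv_mul hdet]
  -- the mean of the two curvatures
  have hmean : ∀ k l m j, connCurv (christoffel g) k l m j u
      = (1 / 2) * (B k m * g u j l - B l m * g u j k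
          + ((if m = k then 1 else 0) * (∑ p, B l p * g u p j)
        - (if m = l then 1 else 0) * ∑ p, B k p * g u p j))
        - ∑ p, (raise g A m k p u * raise g A p l j u - raise g A m l p u * raise g A p k j u) := by
    intro k l m j
    have := connCurv_add_add_connCurv_sub (u := u) (Γ := christoffel g) (a := raise g A)
      (fun m k j => differentiableAt_of_contDiffOn (h.contDiffOn_christoffel m k j) h.isOpen hu
        (by norm_num))
      (fun m k j => differentiableAt_of_contDiffOn (hr m k j) h.isOpen hu (by norm_num)) k l m j
    rw [hflat, hdual'] at this
    linear_combination -(1 / 2) * this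
  have hric : ∀ j k, ricci g j k u
      = (1 / 2) * (B.trace * g u k j - (∑ i, B j i * g u k i)
          + (n * (∑ p, B j p * g u p k) - ∑ p, B j p * g u p k))
        - ∑ i, ∑ p, (raise g A i i p u * raise g A p j k u
            - raise g A i j p u * raise g A p i k u) := by
    intro j k
    simp only [ricci_eq_sum_connCurv, hmean, Finset.sum_sub_distrib, ← Finset.mul_sum,
      Finset.sum_add_distrib, ← Finset.sum_mul, Matrix.trace, Matrix.diag_apply]
    simp
  have hBg : ∀ j, ∑ k, (g u)⁻¹ j k * ∑ p, B j p * g u p k = B j j := by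
    intro j
    rw [← sum_inv_mul_sum hdet (fun m => B j m) j]
    refine Finset.sum_congr rfl fun k _ => congrArg _ (Finset.sum_congr rfl fun p _ => ?_)
    rw [gs p k, mul_comm]
  have hBg' : ∀ j, ∑ k, (g u)⁻¹ j k * ∑ p, B j p * g u k p = B j j := by
    intro j
    rw [← hBg j]
    refine Finset.sum_congr rfl fun k _ => congrArg _ (Finset.sum_congr rfl fun p _ => ?_)
    rw [gs p k]
  have hg1 : ∀ j, ∑ k, (g u)⁻¹ j k * g u k j = 1 := fun j => by rw [sum_inv_mul hdet]; simp
  have hcomm := (hsymm u hu).sum_commutator (inv_symm gs)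
  have hsplit : ∀ j, ∑ k, (g u)⁻¹ j k * ricci g j k u
      = (1 / 2) * (B.trace * (∑ k, (g u)⁻¹ j k * g u k j)
          - (∑ k, (g u)⁻¹ j k * ∑ p, B j p * g u k p)
          + (n * (∑ k, (g u)⁻¹ j k * ∑ p, B j p * g u p k)
            - ∑ k, (g u)⁻¹ j k * ∑ p, B j p * g u p k))
        - ∑ k, (g u)⁻¹ j k * ∑ i, ∑ p, (raise g A i i p u * raise g A p j k u
            - raise g A i j p u * raise g A p i k u) := by
    intro j
    have lin : ∀ (q a b c d : Fin n → ℝ) (t : ℝ),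
        ∑ k, q k * ((1 / 2) * (t * a k - b k + (n * c k - c k)) - d k)
          = (1 / 2) * (t * (∑ k, q k * a k) - (∑ k, q k * b k)
            + (n * (∑ k, q k * c k) - ∑ k, q k * c k)) - ∑ k, q k * d k := by
      intro q a b c d t
      simp only [Finset.mul_sum, ← Finset.sum_add_distrib, ← Finset.sum_sub_distrib]
      exact Finset.sum_congr rfl fun k _ => by ring
    simp only [hric]
    exact lin _ _ _ _ _ _
  simp only [hsplit, hBg, hBg', hg1]
  rw [Finset.sum_sub_distrib]
  have : ∑ j, ∑ k, (g u)⁻¹ j k * ∑ i, ∑ p, (raise g A i i p u * raise g A p j k u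
            - raise g A i j p u * raise g A p i k u) = _ := hcomm
  rw [this]
  simp only [← Finset.mul_sum, Finset.sum_sub_distrib, Finset.sum_add_distrib, Matrix.trace,
    Matrix.diag_apply, Finset.sum_const, Finset.card_univ, Fintype.card_fin, nsmul_eq_mul]
  ring

end Egregium

/-! ### Local hypersurfaces and their relative normalizations -/

section LocalHypersurface

variable {n : ℕ} {U : Set (Coord n)} {u : Coord n} {x ξ y : Coord n → Coord (n + 1)}

theorem fderiv_eq_sum_pd {V : Type*} [NormedAddCommGroup V] [NormedSpace ℝ V] (f : Coord n → V)
    (u w : Coord n) : fderiv ℝ f u w = ∑ i, w i • pd i f u := by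
  have : w = ∑ i, w i • EuclideanSpace.single i (1 : ℝ) := by
    ext j
    simp [Finset.sum_apply, Pi.single_apply]
  conv_lhs => rw [this]
  simp [pd]

/-- A coordinate expression of a hypersurface of class `C⁴` with unit normal field `ξ` and nowhere
vanishing Gaussian curvature. -/
structure IsLocalHypersurface (x ξ : Coord n → Coord (n + 1)) (U : Set (Coord n)) : Prop where
  isOpen : IsOpen U
  contDiffOn : ContDiffOn ℝ 4 x U
  linearIndependent : ∀ v ∈ U, LinearIndependent ℝ fun i => pd i x v
  contDiffOn_normal : ContDiffOn ℝ 2 ξ U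
  norm_normal : ∀ v ∈ U, ‖ξ v‖ = 1
  normal : ∀ v ∈ U, ∀ i, inner ℝ (ξ v) (pd i x v) = 0
  det_ne_zero : ∀ v ∈ U, (hessForm ξ x v).det ≠ 0

/-- A coordinate expression of a relative normalization, characterized by a nonvanishing support
function and tangential derivatives. -/
structure IsLocalNormalization (ξ y : Coord n → Coord (n + 1)) (U : Set (Coord n)) : Prop where
  contDiffOn : ContDiffOn ℝ 1 y U
  support_ne_zero : ∀ v ∈ U, support ξ y v ≠ 0
  inner_pd : ∀ v ∈ U, ∀ i, inner ℝ (ξ v) (pd i y v) = 0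

/-- A vector orthogonal to the normal is tangential. -/
theorem mem_span_pd_of_inner_eq_zero (hx : LinearIndependent ℝ fun i => pd i x u) (hξ : ‖ξ u‖ = 1)
    (hn : ∀ i, inner ℝ (ξ u) (pd i x u) = 0) {w : Coord (n + 1)} (hw : inner ℝ (ξ u) w = 0) :
    w ∈ Submodule.span ℝ (Set.range fun i => pd i x u) := by
  have : Fact (Module.finrank ℝ (Coord (n + 1)) = n + 1) := ⟨by simp⟩
  have h0 : ξ u ≠ 0 := fun h => by simp [h] at hξ
  have hle : Submodule.span ℝ (Set.range fun i => pd i x u) ≤ (Submodule.span ℝ {ξ u})ᗮ := by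
    rw [Submodule.span_le]
    rintro _ ⟨i, rfl⟩
    exact Submodule.mem_orthogonal_singleton_iff_inner_right.2 (hn i)
  rw [Submodule.eq_of_le_of_finrank_eq hle]
  · exact Submodule.mem_orthogonal_singleton_iff_inner_right.2 hw
  · rw [finrank_span_eq_card hx, Submodule.finrank_orthogonal_span_singleton (n := n) h0,
      Fintype.card_fin]

namespace IsLocalHypersurface

theorem contDiffOn_pd (h : IsLocalHypersurface x ξ U) (i : Fin n) : ContDiffOn ℝ 3 (pd i x) U :=
  RelGeom.contDiffOn_pd h.contDiffOn h.isOpen (by norm_num) i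

theorem contDiffOn_pd_pd (h : IsLocalHypersurface x ξ U) (i j : Fin n) :
    ContDiffOn ℝ 2 (pd i (pd j x)) U :=
  RelGeom.contDiffOn_pd (h.contDiffOn_pd j) h.isOpen (by norm_num) i

theorem pd_comm (h : IsLocalHypersurface x ξ U) (hu : u ∈ U) (i j : Fin n) :
    pd i (pd j x) u = pd j (pd i x) u :=
  RelGeom.pd_comm (h.contDiffOn.of_le (by norm_num)) h.isOpen hu i j

theorem pd_pd_comm_right (h : IsLocalHypersurface x ξ U) (hu : u ∈ U) (i j k : Fin n) :
    pd i (pd j (pd k x)) u = pd i (pd k (pd j x)) u :=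
  pd_congr h.isOpen (fun _ hv => h.pd_comm hv j k) hu i

theorem pd_pd_comm_left (h : IsLocalHypersurface x ξ U) (hu : u ∈ U) (i j k : Fin n) :
    pd i (pd j (pd k x)) u = pd j (pd i (pd k x)) u :=
  RelGeom.pd_comm ((h.contDiffOn_pd k).of_le (by norm_num)) h.isOpen hu i j

/-- If `N` is a normal field, then `⟨N_{/k}, x_{/j}⟩ = -⟨N, x_{/jk}⟩`. -/
theorem inner_pd_pd (h : IsLocalHypersurface x ξ U) {N : Coord n → Coord (n + 1)}
    (hN : ContDiffOn ℝ 2 N U) (hNx : ∀ v ∈ U, ∀ i, inner ℝ (N v) (pd i x v) = 0) (hu : u ∈ U)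
    (k j : Fin n) : inner ℝ (pd k N u) (pd j x u) = -hessForm N x u j k := by
  have h1 : pd k (fun v => (inner ℝ (N v) (pd j x v) : ℝ)) u = 0 := by
    rw [pd_congr h.isOpen (fun v hv => hNx v hv j) hu, pd_const]
  rw [pd_inner (differentiableAt_of_contDiffOn hN h.isOpen hu (by norm_num))
    (differentiableAt_of_contDiffOn (h.contDiffOn_pd j) h.isOpen hu (by norm_num))] at h1
  exact eq_neg_of_add_eq_zero_left h1

theorem det_firstForm_ne_zero (h : IsLocalHypersurface x ξ U) (hu : u ∈ U) :
    (firstForm x u).det ≠ 0 :=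
  (Matrix.posDef_gram_of_linearIndependent (h.linearIndependent u hu)).det_pos.ne'

theorem isMetricOn_hessForm (h : IsLocalHypersurface x ξ U) : IsMetricOn (hessForm ξ x) U where
  isOpen := h.isOpen
  contDiffOn i j := h.contDiffOn_normal.inner ℝ (h.contDiffOn_pd_pd j i)
  symm v hv i j := by
    change inner ℝ (ξ v) (pd j (pd i x) v) = inner ℝ (ξ v) (pd i (pd j x) v)
    rw [h.pd_comm hv]
  det_ne_zero := h.det_ne_zero

theorem isMetricOn_firstForm (h : IsLocalHypersurface x ξ U) : IsMetricOn (firstForm x) U where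
  isOpen := h.isOpen
  contDiffOn i j := ((h.contDiffOn_pd i).inner ℝ (h.contDiffOn_pd j)).of_le (by norm_num)
  symm v hv i j := real_inner_comm (pd j x v) (pd i x v)
  det_ne_zero v hv := h.det_firstForm_ne_zero hv

end IsLocalHypersurface

namespace IsLocalNormalization

/-- `q_{/i} = ⟨ξ_{/i}, y⟩`. -/
theorem pd_support (h : IsLocalHypersurface x ξ U) (hy : IsLocalNormalization ξ y U) (hu : u ∈ U)
    (i : Fin n) : pd i (support ξ y) u = inner ℝ (pd i ξ u) (y u) := by
  change pd i (fun v => (inner ℝ (ξ v) (y v) : ℝ)) u = _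
  rw [pd_inner (differentiableAt_of_contDiffOn h.contDiffOn_normal h.isOpen hu (by norm_num))
    (differentiableAt_of_contDiffOn hy.contDiffOn h.isOpen hu (by norm_num)),
    hy.inner_pd u hu i, add_zero]

/-- The support function of a relative normalization of class `C¹` is of class `C²`. -/
theorem contDiffOn_support (h : IsLocalHypersurface x ξ U) (hy : IsLocalNormalization ξ y U) :
    ContDiffOn ℝ 2 (support ξ y) U := by
  have h1 : ContDiffOn ℝ 1 (support ξ y) U :=
    (h.contDiffOn_normal.of_le (by norm_num)).inner ℝ hy.contDiffOn
  rw [show (2 : WithTop ℕ∞) = 1 + 1 by norm_num, contDiffOn_succ_iff_fderiv_of_isOpen h.isOpen]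
  refine ⟨h1.differentiableOn (by norm_num), by simp, contDiffOn_clm_apply.2 fun w => ?_⟩
  have h2 : ContDiffOn ℝ 1 (fun v => ∑ i, w i • (inner ℝ (pd i ξ v) (y v) : ℝ)) U :=
    ContDiffOn.sum fun i _ => ContDiffOn.const_smul (w i)
      ((contDiffOn_pd h.contDiffOn_normal h.isOpen (by norm_num) i).inner ℝ hy.contDiffOn)
  refine h2.congr fun v hv => ?_
  rw [fderiv_eq_sum_pd]
  exact Finset.sum_congr rfl fun i _ => by rw [hy.pd_support h hv]

theorem contDiffOn_conormal (h : IsLocalHypersurface x ξ U) (hy : IsLocalNormalization ξ y U) :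
    ContDiffOn ℝ 2 (conormal ξ y) U :=
  ((hy.contDiffOn_support h).inv hy.support_ne_zero).smul h.contDiffOn_normal

theorem inner_conormal_pd_eq_zero (h : IsLocalHypersurface x ξ U) {v : Coord n} (hv : v ∈ U)
    (i : Fin n) : inner ℝ (conormal ξ y v) (pd i x v) = 0 :=
  inner_conormal_pd x ξ y v i (h.normal v hv i)

theorem relMetric_eq (x ξ y : Coord n → Coord (n + 1)) (u : Coord n) :
    relMetric x ξ y u = (support ξ y u)⁻¹ • hessForm ξ x u := by
  ext i j
  simp [relMetric, hessForm, conormal, real_inner_smul_left]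

theorem isMetricOn (h : IsLocalHypersurface x ξ U) (hy : IsLocalNormalization ξ y U) :
    IsMetricOn (relMetric x ξ y) U where
  isOpen := h.isOpen
  contDiffOn i j := (hy.contDiffOn_conormal h).inner ℝ (h.contDiffOn_pd_pd j i)
  symm v hv i j := by
    change inner ℝ _ (pd j (pd i x) v) = inner ℝ _ (pd i (pd j x) v)
    rw [h.pd_comm hv]
  det_ne_zero v hv := by
    rw [relMetric_eq, Matrix.det_smul]
    exact mul_ne_zero (pow_ne_zero _ (inv_ne_zero (hy.support_ne_zero v hv))) (h.det_ne_zero v hv)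

theorem inner_pd_conormal_pd (h : IsLocalHypersurface x ξ U) (hy : IsLocalNormalization ξ y U)
    (hu : u ∈ U) (k j : Fin n) :
    inner ℝ (pd k (conormal ξ y) u) (pd j x u) = -relMetric x ξ y u j k :=
  h.inner_pd_pd (hy.contDiffOn_conormal h) (fun _ hv i => inner_conormal_pd_eq_zero h hv i) hu k j

theorem inner_pd_conormal_self (h : IsLocalHypersurface x ξ U) (hy : IsLocalNormalization ξ y U)
    (hu : u ∈ U) (k : Fin n) : inner ℝ (pd k (conormal ξ y) u) (y u) = 0 := by
  have h1 : pd k (fun v => (inner ℝ (conormal ξ y v) (y v) : ℝ)) u = 0 := by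
    rw [pd_congr h.isOpen (fun v hv => inner_conormal_self ξ y v (hy.support_ne_zero v hv)) hu,
      pd_const]
  rw [pd_inner (differentiableAt_of_contDiffOn (hy.contDiffOn_conormal h) h.isOpen hu
      (by norm_num)) (differentiableAt_of_contDiffOn hy.contDiffOn h.isOpen hu (by norm_num))] at h1
  have h2 : inner ℝ (conormal ξ y u) (pd k y u) = 0 := by
    rw [conormal, real_inner_smul_left, hy.inner_pd u hu, mul_zero]
  rwa [h2, add_zero] at h1

/-- `G_{jk/l} = ⟨X_{/l}, x_{/jk}⟩ + ⟨X, x_{/jkl}⟩`. -/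
theorem pd_relMetric (h : IsLocalHypersurface x ξ U) (hy : IsLocalNormalization ξ y U)
    (hu : u ∈ U) (l j k : Fin n) : pd l (fun v => relMetric x ξ y v j k) u
      = inner ℝ (pd l (conormal ξ y) u) (pd k (pd j x) u)
        + inner ℝ (conormal ξ y u) (pd l (pd k (pd j x)) u) :=
  pd_inner (differentiableAt_of_contDiffOn (hy.contDiffOn_conormal h) h.isOpen hu (by norm_num))
    (differentiableAt_of_contDiffOn (h.contDiffOn_pd_pd k j) h.isOpen hu (by norm_num)) l

/-- The Darboux tensor in terms of ordinary partial derivatives: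
`A_{jkl} = ⟨X, x_{/jkl}⟩ - (G_{jk/l} + G_{kl/j} + G_{jl/k}) / 2`. -/
theorem darboux_eq (h : IsLocalHypersurface x ξ U) (hy : IsLocalNormalization ξ y U)
    (hu : u ∈ U) (j k l : Fin n) : darboux x ξ y j k l u
      = inner ℝ (conormal ξ y u) (pd l (pd k (pd j x)) u)
        - (1 / 2) * (pd l (fun v => relMetric x ξ y v j k) u
          + pd j (fun v => relMetric x ξ y v k l) u + pd k (fun v => relMetric x ξ y v j l) u) := by
  have hG := hy.isMetricOn h
  have dx : ∀ i, DifferentiableAt ℝ (pd i x) u := fun i =>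
    differentiableAt_of_contDiffOn (h.contDiffOn_pd i) h.isOpen hu (by norm_num)
  have dxx : ∀ i j, DifferentiableAt ℝ (pd i (pd j x)) u := fun i j =>
    differentiableAt_of_contDiffOn (h.contDiffOn_pd_pd i j) h.isOpen hu (by norm_num)
  have dΓ : ∀ m i j, DifferentiableAt ℝ (christoffel (relMetric x ξ y) m i j) u := fun m i j =>
    differentiableAt_of_contDiffOn (hG.contDiffOn_christoffel m i j) h.isOpen hu (by norm_num)
  have hX : ∀ i, inner ℝ (conormal ξ y u) (pd i x u) = 0 := inner_conormal_pd_eq_zero h hu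
  have hXX : ∀ i j, inner ℝ (conormal ξ y u) (pd j (pd i x) u) = relMetric x ξ y u i j :=
    fun i j => rfl
  have h1 : ∀ k j, inner ℝ (conormal ξ y u)
      (covDerivOne (relMetric x ξ y) (fun i => pd i x) k j u) = relMetric x ξ y u j k := by
    intro k j
    simp only [covDerivOne, inner_sub_right, inner_sum, real_inner_smul_right, hX, mul_zero,
      Finset.sum_const_zero, sub_zero, hXX]
  have h2 : inner ℝ (conormal ξ y u)
      (pd l (covDerivOne (relMetric x ξ y) (fun i => pd i x) k j) u)
      = inner ℝ (conormal ξ y u) (pd l (pd k (pd j x)) u)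
        - ∑ m, christoffel (relMetric x ξ y) m k j u * relMetric x ξ y u m l := by
    have : pd l (covDerivOne (relMetric x ξ y) (fun i => pd i x) k j) u
        = pd l (pd k (pd j x)) u - ∑ m, (pd l (christoffel (relMetric x ξ y) m k j) u • pd m x u
          + christoffel (relMetric x ξ y) m k j u • pd l (pd m x) u) := by
      change pd l (fun v => pd k (pd j x) v
        - ∑ m, christoffel (relMetric x ξ y) m k j v • pd m x v) u = _
      rw [pd_sub (dxx k j) (DifferentiableAt.fun_sum fun m _ => (dΓ m k j).fun_smul (dx m)),
        pd_sum fun m _ => (dΓ m k j).fun_smul (dx m)]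
      exact congrArg _ (Finset.sum_congr rfl fun m _ => pd_smul (dΓ m k j) (dx m) l)
    rw [this]
    simp only [inner_sub_right, inner_sum, inner_add_right, real_inner_smul_right, hX, mul_zero,
      zero_add, hXX]
  have h3 : ∀ p i j, ∑ m, christoffel (relMetric x ξ y) m i j u * relMetric x ξ y u p m
      = (1 / 2) * (pd i (fun v => relMetric x ξ y v j p) u
      + pd j (fun v => relMetric x ξ y v i p) u - pd p (fun v => relMetric x ξ y v i j) u) := by
    intro p i j
    rw [← hG.sum_mul_christoffel hu]
    exact Finset.sum_congr rfl fun m _ => mul_comm _ _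
  rw [darboux, covDerivTwo, inner_sub_right, inner_sub_right, h2, inner_sum, inner_sum]
  simp only [real_inner_smul_right, h1]
  simp only [hG.symm u hu _ l, hG.symm u hu _ k, h3]
  rw [hG.pd_symm hu k l j, hG.pd_symm hu j l k, hG.pd_symm hu l k j]
  ring

theorem isCubicForm_darboux (h : IsLocalHypersurface x ξ U) (hy : IsLocalNormalization ξ y U)
    (hu : u ∈ U) : IsCubicForm fun j k l => darboux x ξ y j k l u := by
  have hG := hy.isMetricOn h
  constructor
  · intro i j k
    simp only [hy.darboux_eq h hu]
    rw [h.pd_pd_comm_right hu k j i, hG.pd_symm hu k i j]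
    ring
  · intro i j k
    simp only [hy.darboux_eq h hu]
    rw [h.pd_pd_comm_left hu k j i, hG.pd_symm hu i j k]
    ring

/-- The coefficients of the connection induced by `y`, with the upper index lowered:
`-⟨X_{/p}, x_{/jk}⟩ = G_{pm} Γ^m_{kj} + A_{pkj}`. -/
theorem neg_inner_pd_conormal_pd_pd (h : IsLocalHypersurface x ξ U)
    (hy : IsLocalNormalization ξ y U) (hu : u ∈ U) (p k j : Fin n) :
    -inner ℝ (pd p (conormal ξ y) u) (pd k (pd j x) u)
      = ∑ m, relMetric x ξ y u p m * christoffel (relMetric x ξ y) m k j u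
        + darboux x ξ y p k j u := by
  have hG := hy.isMetricOn h
  have h1 := hy.pd_relMetric h hu p j k
  rw [hG.sum_mul_christoffel hu, hy.darboux_eq h hu, h.pd_pd_comm_left hu j k p,
    h.pd_pd_comm_right hu k j p, h.pd_pd_comm_left hu k p j, hG.pd_symm hu k p j,
    hG.pd_symm hu j p k, hG.pd_symm hu p k j]
  linear_combination h1

theorem contDiffOn_darboux (h : IsLocalHypersurface x ξ U) (hy : IsLocalNormalization ξ y U)
    (p k j : Fin n) : ContDiffOn ℝ 1 (darboux x ξ y p k j) U := by
  have hG := hy.isMetricOn h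
  have h1 : ContDiffOn ℝ 1 (fun v => -inner ℝ (pd p (conormal ξ y) v) (pd k (pd j x) v)
      - ∑ m, relMetric x ξ y v p m * christoffel (relMetric x ξ y) m k j v) U := by
    refine ContDiffOn.sub (ContDiffOn.neg ?_) (ContDiffOn.sum fun m _ => ?_)
    · exact (contDiffOn_pd (hy.contDiffOn_conormal h) h.isOpen (by norm_num) p).inner ℝ
        ((h.contDiffOn_pd_pd k j).of_le (by norm_num))
    · exact ((hG.contDiffOn p m).of_le (by norm_num)).mul (hG.contDiffOn_christoffel m k j)
  refine h1.congr fun v hv => ?_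
  rw [hy.neg_inner_pd_conormal_pd_pd h hv]
  ring

end IsLocalNormalization

end LocalHypersurface

/-! ### The structure equations of a relative normalization -/

section Structure

variable {n : ℕ} {U : Set (Coord n)} {u : Coord n} {x ξ y : Coord n → Coord (n + 1)}

/-- The coefficients `Λ^m_{kj} = Γ^m_{kj} + A^m_{kj}` of the connection induced by the relative
normalization `y`. -/
def inducedConn (x ξ y : Coord n → Coord (n + 1)) (m k j : Fin n) (u : Coord n) : ℝ :=
  christoffel (relMetric x ξ y) m k j u + raise (relMetric x ξ y) (darboux x ξ y) m k j u

namespace IsLocalNormalization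

theorem contDiffOn_inducedConn (h : IsLocalHypersurface x ξ U)
    (hy : IsLocalNormalization ξ y U) (m k j : Fin n) :
    ContDiffOn ℝ 1 (inducedConn x ξ y m k j) U :=
  ((hy.isMetricOn h).contDiffOn_christoffel m k j).add (ContDiffOn.sum fun p _ =>
    (((hy.isMetricOn h).contDiffOn_inv m p).of_le (by norm_num)).mul
      (hy.contDiffOn_darboux h p k j))

theorem inner_pd_conormal_pd_pd (h : IsLocalHypersurface x ξ U)
    (hy : IsLocalNormalization ξ y U) (hu : u ∈ U) (p k j : Fin n) :
    inner ℝ (pd p (conormal ξ y) u) (pd k (pd j x) u)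
      = -∑ m, relMetric x ξ y u p m * inducedConn x ξ y m k j u := by
  simp only [inducedConn, mul_add, Finset.sum_add_distrib, sum_mul_raise (hy.isMetricOn h) hu]
  rw [← hy.neg_inner_pd_conormal_pd_pd h hu, neg_neg]

theorem pd_eq_shapeOp (h : IsLocalHypersurface x ξ U) (hy : IsLocalNormalization ξ y U)
    (hu : u ∈ U) (i : Fin n) : pd i y u = -∑ j, shapeOp x y u i j • pd j x u :=
  RelGeom.pd_eq_shapeOp x y u (h.linearIndependent u hu) i
    (mem_span_pd_of_inner_eq_zero (h.linearIndependent u hu) (h.norm_normal u hu) (h.normal u hu)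
      (hy.inner_pd u hu i))

/-- The covectors `X, X_{/1}, …, X_{/n}` separate vectors, because the relative metric is
nondegenerate. -/
theorem eq_zero_of_inner_conormal (h : IsLocalHypersurface x ξ U)
    (hy : IsLocalNormalization ξ y U) (hu : u ∈ U) {w : Coord (n + 1)}
    (h0 : inner ℝ (conormal ξ y u) w = 0) (h1 : ∀ p, inner ℝ (pd p (conormal ξ y) u) w = 0) :
    w = 0 := by
  have hw : inner ℝ (ξ u) w = 0 := by
    rw [conormal, real_inner_smul_left] at h0
    exact (mul_eq_zero.1 h0).resolve_left (inv_ne_zero (hy.support_ne_zero u hu))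
  obtain ⟨c, rfl⟩ := (Submodule.mem_span_range_iff_exists_fun ℝ).1
    (mem_span_pd_of_inner_eq_zero (h.linearIndependent u hu) (h.norm_normal u hu) (h.normal u hu)
      hw)
  have hG := hy.isMetricOn h
  have h2 : ∀ p, ∑ m, relMetric x ξ y u p m * c m = 0 := by
    intro p
    have := h1 p
    simp only [inner_sum, real_inner_smul_right, hy.inner_pd_conormal_pd h hu, mul_neg,
      Finset.sum_neg_distrib, neg_eq_zero] at this
    rw [← this]
    exact Finset.sum_congr rfl fun m _ => by rw [hG.symm u hu p m, mul_comm]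
  have h3 : ∀ m, c m = 0 := fun m => by
    rw [← sum_inv_mul_sum (hG.det_ne_zero u hu) c m]
    simp only [h2, mul_zero, Finset.sum_const_zero]
  simp [h3]

/-- The Gauss equation `x_{/jk} = Λ^m_{kj} x_{/m} + G_{jk} y`. -/
theorem pd_pd_eq (h : IsLocalHypersurface x ξ U) (hy : IsLocalNormalization ξ y U) (hu : u ∈ U)
    (k j : Fin n) : pd k (pd j x) u
      = (∑ m, inducedConn x ξ y m k j u • pd m x u) + relMetric x ξ y u j k • y u := by
  rw [← sub_eq_zero]
  have hG := hy.isMetricOn h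
  refine hy.eq_zero_of_inner_conormal h hu ?_ fun p => ?_
  · simp only [inner_sub_right, inner_add_right, inner_sum, real_inner_smul_right,
      inner_conormal_pd_eq_zero h hu, inner_conormal_self ξ y u (hy.support_ne_zero u hu)]
    simp [relMetric, hessForm]
  · simp only [inner_sub_right, inner_add_right, inner_sum, real_inner_smul_right,
      hy.inner_pd_conormal_pd h hu, hy.inner_pd_conormal_self h hu,
      hy.inner_pd_conormal_pd_pd h hu, mul_zero, add_zero, mul_neg, Finset.sum_neg_distrib]
    rw [sub_eq_zero, neg_inj]
    exact Finset.sum_congr rfl fun m _ => by rw [hG.symm u hu p m, mul_comm]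

/-- The curvature of the induced connection, from the integrability condition of the Gauss
equation. -/
theorem connCurv_inducedConn (h : IsLocalHypersurface x ξ U) (hy : IsLocalNormalization ξ y U)
    (hu : u ∈ U) (k l m j : Fin n) : connCurv (inducedConn x ξ y) k l m j u
      = shapeOp x y u k m * relMetric x ξ y u j l - shapeOp x y u l m * relMetric x ξ y u j k := by
  have hG := hy.isMetricOn h
  have dx : ∀ i, DifferentiableAt ℝ (pd i x) u := fun i =>
    differentiableAt_of_contDiffOn (h.contDiffOn_pd i) h.isOpen hu (by norm_num)
  have dΛ : ∀ m i j, DifferentiableAt ℝ (inducedConn x ξ y m i j) u := fun m i j =>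
    differentiableAt_of_contDiffOn (hy.contDiffOn_inducedConn h m i j) h.isOpen hu (by norm_num)
  have dG : ∀ i j, DifferentiableAt ℝ (fun v => relMetric x ξ y v i j) u := fun i j =>
    differentiableAt_of_contDiffOn (hG.contDiffOn i j) h.isOpen hu (by norm_num)
  have dy : DifferentiableAt ℝ y u :=
    differentiableAt_of_contDiffOn hy.contDiffOn h.isOpen hu (by norm_num)
  let F : Fin n → Fin n → Fin n → ℝ := fun k l m => pd l (inducedConn x ξ y m k j) u
    + ∑ r, inducedConn x ξ y m l r u * inducedConn x ξ y r k j u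
    - shapeOp x y u l m * relMetric x ξ y u j k
  -- `F k l m` are the tangential components of `x_{/jkl}`; pairing with `X_{/p}` extracts them
  have hF : ∀ k l p, ∑ m, relMetric x ξ y u p m * F k l m
      = -inner ℝ (pd p (conormal ξ y) u) (pd l (pd k (pd j x)) u) := by
    intro k l p
    have h1 : pd l (pd k (pd j x)) u
        = (∑ m, (pd l (inducedConn x ξ y m k j) u • pd m x u
            + inducedConn x ξ y m k j u • pd l (pd m x) u))
          + (pd l (fun v => relMetric x ξ y v j k) u • y u
            + relMetric x ξ y u j k • pd l y u) := by
      rw [pd_congr h.isOpen (fun v hv => hy.pd_pd_eq h hv k j) hu,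
        pd_add (DifferentiableAt.fun_sum fun m _ => (dΛ m k j).fun_smul (dx m))
          ((dG j k).fun_smul dy),
        pd_sum fun m _ => (dΛ m k j).fun_smul (dx m), pd_smul (dG j k) dy]
      exact congrArg (· + _) (Finset.sum_congr rfl fun m _ => pd_smul (dΛ m k j) (dx m) l)
    rw [h1, hy.pd_eq_shapeOp h hu]
    simp only [inner_add_right, inner_sum, real_inner_smul_right, inner_neg_right,
      hy.inner_pd_conormal_pd h hu, hy.inner_pd_conormal_self h hu,
      hy.inner_pd_conormal_pd_pd h hu, mul_zero, zero_add, mul_neg, Finset.sum_neg_distrib,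
      Finset.sum_add_distrib, neg_neg, F, mul_sub, mul_add, Finset.sum_sub_distrib, neg_add]
    have e1 : ∑ m, pd l (inducedConn x ξ y m k j) u * relMetric x ξ y u m p
        = ∑ m, relMetric x ξ y u p m * pd l (inducedConn x ξ y m k j) u :=
      Finset.sum_congr rfl fun m _ => by rw [hG.symm u hu p m, mul_comm]
    have e2 : ∑ i, inducedConn x ξ y i k j u
          * ∑ m, relMetric x ξ y u p m * inducedConn x ξ y m l i u
        = ∑ m, relMetric x ξ y u p m
          * ∑ r, inducedConn x ξ y m l r u * inducedConn x ξ y r k j u := by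
      simp only [Finset.mul_sum]
      rw [Finset.sum_comm]
      exact Finset.sum_congr rfl fun m _ => Finset.sum_congr rfl fun r _ => by ring
    have e3 : relMetric x ξ y u j k * ∑ m, shapeOp x y u l m * relMetric x ξ y u m p
        = ∑ m, relMetric x ξ y u p m * (shapeOp x y u l m * relMetric x ξ y u j k) := by
      rw [Finset.mul_sum]
      exact Finset.sum_congr rfl fun m _ => by rw [hG.symm u hu p m]; ring
    rw [e1, e2, e3]
    ring
  have hFF : F l k m = F k l m := by
    rw [← sum_inv_mul_sum (hG.det_ne_zero u hu) (F l k) m,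
      ← sum_inv_mul_sum (hG.det_ne_zero u hu) (F k l) m]
    simp only [hF, h.pd_pd_comm_left hu k l j]
  simp only [F] at hFF
  rw [connCurv, Finset.sum_sub_distrib]
  linear_combination hFF

/-- The theorema egregium of relative differential geometry. -/
theorem sum_inv_mul_ricci (h : IsLocalHypersurface x ξ U) (hy : IsLocalNormalization ξ y U)
    (hu : u ∈ U) : ∑ j, ∑ k, (relMetric x ξ y u)⁻¹ j k * ricci (relMetric x ξ y) j k u
      = ((n : ℝ) - 1) * (shapeOp x y u).trace
        + cubicInner (relMetric x ξ y u)⁻¹ (fun i j k => darboux x ξ y i j k u)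
          (fun i j k => darboux x ξ y i j k u)
        - ∑ j, ∑ k, (relMetric x ξ y u)⁻¹ j k
          * (cubicTrace (relMetric x ξ y u)⁻¹ (fun i j k => darboux x ξ y i j k u) j
            * cubicTrace (relMetric x ξ y u)⁻¹ (fun i j k => darboux x ξ y i j k u) k) :=
  (hy.isMetricOn h).sum_inv_mul_ricci (hy.contDiffOn_darboux h)
    (fun _ hv => hy.isCubicForm_darboux h hv) (shapeOp x y u) hu (hy.connCurv_inducedConn h hu)

/-- The mean curvature drops out of the invariant: it depends on the cubic form only. -/
theorem relFun_eq (h : IsLocalHypersurface x ξ U) (hy : IsLocalNormalization ξ y U)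
    (hu : u ∈ U) (hn : 2 ≤ n) : relFun x ξ y u
      = 1 / ((n : ℝ) * (n - 1)) * (((n : ℝ) + 2)
        * cubicInner (relMetric x ξ y u)⁻¹ (fun i j k => darboux x ξ y i j k u)
          (fun i j k => darboux x ξ y i j k u)
        - 3 * ∑ j, ∑ k, (relMetric x ξ y u)⁻¹ j k
          * (cubicTrace (relMetric x ξ y u)⁻¹ (fun i j k => darboux x ξ y i j k u) j
            * cubicTrace (relMetric x ξ y u)⁻¹ (fun i j k => darboux x ξ y i j k u) k))
        / support ξ y u := by
  have hn' : (2 : ℝ) ≤ n := by exact_mod_cast hn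
  have h1 : (n : ℝ) ≠ 0 := by linarith
  have h2 : (n : ℝ) - 1 ≠ 0 := by linarith
  have hJ : pick x ξ y u = 1 / ((n : ℝ) * (n - 1))
      * cubicInner (relMetric x ξ y u)⁻¹ (fun i j k => darboux x ξ y i j k u)
          (fun i j k => darboux x ξ y i j k u) := rfl
  rw [relFun, hJ, scalarCurv, hy.sum_inv_mul_ricci h hu, meanCurv]
  congr 1
  field_simp
  ring

end IsLocalNormalization

end Structure

/-! ### Change of the normalization -/

section Conformal

variable {n : ℕ} {Q h : Matrix (Fin n) (Fin n) ℝ}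

theorem cubicInner_comm (hQ : ∀ i j, Q i j = Q j i) (A C : Fin n → Fin n → Fin n → ℝ) :
    cubicInner Q A C = cubicInner Q C A := by
  simp only [cubicInner, ← Fintype.sum_prod_type']
  refine Finset.sum_nbij' (fun ⟨j, k, l, a, b, c⟩ => (a, b, c, j, k, l))
    (fun ⟨j, k, l, a, b, c⟩ => (a, b, c, j, k, l)) (by simp) (by simp) (fun _ _ => rfl)
    (fun _ _ => rfl) ?_
  rintro ⟨j, k, l, a, b, c⟩ -
  dsimp only
  rw [hQ a j, hQ b k, hQ c l]
  ring

theorem cubicInner_smul (t r : ℝ) (A C : Fin n → Fin n → Fin n → ℝ) :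
    cubicInner (t • Q) (fun i j k => r * A i j k) (fun i j k => r * C i j k)
      = t ^ 3 * r ^ 2 * cubicInner Q A C := by
  simp only [cubicInner, Finset.mul_sum, Matrix.smul_apply, smul_eq_mul]
  iterate 6 refine Finset.sum_congr rfl fun _ _ => ?_
  ring

theorem cubicTrace_smul (t r : ℝ) (A : Fin n → Fin n → Fin n → ℝ) (j : Fin n) :
    cubicTrace (t • Q) (fun i j k => r * A i j k) j = t * r * cubicTrace Q A j := by
  simp only [cubicTrace, Finset.mul_sum, Matrix.smul_apply, smul_eq_mul]
  iterate 2 refine Finset.sum_congr rfl fun _ _ => ?_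
  ring

/-- The symmetrization `(s_l h_{jk} + s_j h_{kl} + s_k h_{jl}) / 2` of the product of a covector and
a metric. -/
def symProd (s : Fin n → ℝ) (h : Matrix (Fin n) (Fin n) ℝ) (j k l : Fin n) : ℝ :=
  (1 / 2) * (s l * h j k + s j * h k l + s k * h j l)

/-- `Q` is the inverse of the metric `h` at a point; both matrices are symmetric. -/
structure IsInvMetric (Q h : Matrix (Fin n) (Fin n) ℝ) : Prop where
  symm_inv : ∀ i j, Q i j = Q j i
  symm : ∀ i j, h i j = h j i
  sum_mul : ∀ i j, ∑ k, Q i k * h k j = if i = j then 1 else 0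

theorem IsInvMetric.cubicTrace_symProd (hQ : IsInvMetric Q h) (s : Fin n → ℝ) (j : Fin n) :
    cubicTrace Q (symProd s h) j = ((n : ℝ) + 2) / 2 * s j := by
  have e1 : ∑ k, ∑ l, Q k l * (s l * h j k) = s j := by
    rw [Finset.sum_comm]
    have : ∀ l, ∑ k, Q k l * (s l * h j k) = s l * ∑ k, Q l k * h k j := by
      intro l
      rw [Finset.mul_sum]
      exact Finset.sum_congr rfl fun k _ => by rw [hQ.symm_inv k l, hQ.symm j k]; ring
    simp [this, hQ.sum_mul]
  have e2 : ∑ k, ∑ l, Q k l * (s j * h k l) = n * s j := by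
    have : ∀ k, ∑ l, Q k l * (s j * h k l) = s j * ∑ l, Q k l * h l k := by
      intro k
      rw [Finset.mul_sum]
      exact Finset.sum_congr rfl fun l _ => by rw [hQ.symm k l]; ring
    simp [this, hQ.sum_mul]
  have e3 : ∑ k, ∑ l, Q k l * (s k * h j l) = s j := by
    have : ∀ k, ∑ l, Q k l * (s k * h j l) = s k * ∑ l, Q k l * h l j := by
      intro k
      rw [Finset.mul_sum]
      exact Finset.sum_congr rfl fun l _ => by rw [hQ.symm j l]; ring
    simp [this, hQ.sum_mul]
  have : cubicTrace Q (symProd s h) j = (1 / 2) * ((∑ k, ∑ l, Q k l * (s l * h j k))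
      + (∑ k, ∑ l, Q k l * (s j * h k l)) + ∑ k, ∑ l, Q k l * (s k * h j l)) := by
    simp only [cubicTrace, symProd, Finset.mul_sum, ← Finset.sum_add_distrib]
    iterate 2 refine Finset.sum_congr rfl fun _ _ => ?_
    ring
  rw [this, e1, e2, e3]
  ring

theorem cubicTrace_add (A C : Fin n → Fin n → Fin n → ℝ) (j : Fin n) :
    cubicTrace Q (fun i j k => A i j k + C i j k) j = cubicTrace Q A j + cubicTrace Q C j := by
  simp only [cubicTrace, mul_add, Finset.sum_add_distrib]

theorem cubicInner_add (A C D : Fin n → Fin n → Fin n → ℝ) :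
    cubicInner Q A (fun i j k => C i j k + D i j k) = cubicInner Q A C + cubicInner Q A D := by
  simp only [cubicInner, mul_add, Finset.sum_add_distrib]

theorem IsInvMetric.cubicInner_symProd (hQ : IsInvMetric Q h) {E : Fin n → Fin n → Fin n → ℝ}
    (hE : IsCubicForm E) (s : Fin n → ℝ) :
    cubicInner Q E (symProd s h) = 3 / 2 * ∑ j, ∑ a, Q j a * (cubicTrace Q E j * s a) := by
  have e1 : cubicInner Q E (fun a b c => s a * h b c)
      = ∑ j, ∑ a, Q j a * (cubicTrace Q E j * s a) := by
    have e : ∀ j k l a, ∑ b, ∑ c, Q j a * Q k b * Q l c * E j k l * (s a * h b c)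
        = Q j a * s a * (Q k l * E j k l) := by
      intro j k l a
      have : ∀ b, ∑ c, Q j a * Q k b * Q l c * E j k l * (s a * h b c)
          = Q j a * E j k l * s a * Q k b * ∑ c, Q l c * h c b := by
        intro b
        rw [Finset.mul_sum]
        exact Finset.sum_congr rfl fun c _ => by rw [hQ.symm b c]; ring
      simp only [this, hQ.sum_mul, mul_ite, mul_one, mul_zero, Finset.sum_ite_eq, Finset.mem_univ,
        if_true]
      ring
    simp only [cubicInner, e]
    refine Finset.sum_congr rfl fun j _ => ?_
    simp only [cubicTrace, Finset.mul_sum, Finset.sum_mul]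
    simp only [← Fintype.sum_prod_type']
    refine Finset.sum_nbij' (fun ⟨k, l, a⟩ => (a, k, l)) (fun ⟨a, k, l⟩ => (k, l, a))
      (by simp) (by simp) (fun _ _ => rfl) (fun _ _ => rfl) ?_
    rintro ⟨k, l, a⟩ -
    ring
  have e2 : cubicInner Q E (fun a b c => s c * h a b) =
      cubicInner Q E (fun a b c => s a * h b c) := by
    simp only [cubicInner, ← Fintype.sum_prod_type']
    refine Finset.sum_nbij' (fun ⟨j, k, l, a, b, c⟩ => (l, j, k, c, a, b))
      (fun ⟨l, j, k, c, a, b⟩ => (j, k, l, a, b, c)) (by simp) (by simp) (fun _ _ => rfl)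
      (fun _ _ => rfl) ?_
    rintro ⟨j, k, l, a, b, c⟩ -
    dsimp only
    rw [hE.1 l j k, hE.2 j l k]
    ring
  have e3 : cubicInner Q E (fun a b c => s b * h a c) =
      cubicInner Q E (fun a b c => s a * h b c) := by
    simp only [cubicInner, ← Fintype.sum_prod_type']
    refine Finset.sum_nbij' (fun ⟨j, k, l, a, b, c⟩ => (k, j, l, b, a, c))
      (fun ⟨k, j, l, b, a, c⟩ => (j, k, l, a, b, c)) (by simp) (by simp) (fun _ _ => rfl)
      (fun _ _ => rfl) ?_
    rintro ⟨j, k, l, a, b, c⟩ -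
    dsimp only
    rw [hE.1 k j l]
    ring
  have : cubicInner Q E (symProd s h) = (1 / 2) * (cubicInner Q E (fun a b c => s c * h a b)
      + cubicInner Q E (fun a b c => s a * h b c) + cubicInner Q E (fun a b c => s b * h a c)) := by
    rw [← cubicInner_add, ← cubicInner_add]
    simp only [cubicInner, Finset.mul_sum]
    iterate 6 refine Finset.sum_congr rfl fun _ _ => ?_
    simp only [symProd]
    ring
  rw [this, e2, e3, e1]
  ring

theorem IsInvMetric.isCubicForm_symProd (hQ : IsInvMetric Q h) (s : Fin n → ℝ) :
    IsCubicForm (symProd s h) := by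
  constructor
  · intro i j k
    rw [symProd, symProd, hQ.symm i j]
    ring
  · intro i j k
    rw [symProd, symProd, hQ.symm j k]
    ring

theorem IsCubicForm.add {A C : Fin n → Fin n → Fin n → ℝ} (hA : IsCubicForm A)
    (hC : IsCubicForm C) : IsCubicForm fun i j k => A i j k + C i j k :=
  ⟨fun i j k => congrArg₂ (· + ·) (hA.1 i j k) (hC.1 i j k),
    fun i j k => congrArg₂ (· + ·) (hA.2 i j k) (hC.2 i j k)⟩

/-- The traceless part of a cubic form `C + sym(s ⊗ h)`, for `C` traceless, is `C`; its norm is a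
combination of the norms of the form and of its trace. -/
theorem IsInvMetric.cubicInner_add_symProd (hQ : IsInvMetric Q h)
    {C : Fin n → Fin n → Fin n → ℝ} (hC : IsCubicForm C) (hC0 : ∀ j, cubicTrace Q C j = 0)
    (s : Fin n → ℝ) :
    ((n : ℝ) + 2) * cubicInner Q (fun i j k => C i j k + symProd s h i j k)
        (fun i j k => C i j k + symProd s h i j k)
      - 3 * ∑ j, ∑ k, Q j k * (cubicTrace Q (fun i j k => C i j k + symProd s h i j k) j
        * cubicTrace Q (fun i j k => C i j k + symProd s h i j k) k)
      = ((n : ℝ) + 2) * cubicInner Q C C := by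
  have hE := hC.add (hQ.isCubicForm_symProd s)
  have htr : ∀ j, cubicTrace Q (fun i j k => C i j k + symProd s h i j k) j
      = ((n : ℝ) + 2) / 2 * s j := fun j => by
    rw [cubicTrace_add, hC0, hQ.cubicTrace_symProd, zero_add]
  rw [cubicInner_add, hQ.cubicInner_symProd hE, cubicInner_comm hQ.symm_inv, cubicInner_add,
    hQ.cubicInner_symProd hC]
  simp only [htr, hC0, zero_mul, mul_zero, Finset.sum_const_zero, add_zero]
  have : ∑ j, ∑ k, Q j k * (((n : ℝ) + 2) / 2 * s j * (((n : ℝ) + 2) / 2 * s k))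
      = ((n : ℝ) + 2) / 2 * ∑ j, ∑ k, Q j k * (((n : ℝ) + 2) / 2 * s j * s k) := by
    simp only [Finset.mul_sum]
    iterate 2 refine Finset.sum_congr rfl fun _ _ => ?_
    ring
  rw [this]
  ring

end Conformal

/-! ### Comparison with the equiaffine normalization -/

section Equiaffine

variable {n : ℕ} {U : Set (Coord n)} {u : Coord n} {x ξ y : Coord n → Coord (n + 1)}

/-- The cubic form `⟨ξ, x_{/jkl}⟩ - (h_{jk/l} + h_{kl/j} + h_{jl/k}) / 2` of the Euclidean
normalization. -/
def normalCubic (x ξ : Coord n → Coord (n + 1)) (u : Coord n) (j k l : Fin n) : ℝ :=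
  inner ℝ (ξ u) (pd l (pd k (pd j x)) u)
    - (1 / 2) * (pd l (fun v => hessForm ξ x v j k) u
      + pd j (fun v => hessForm ξ x v k l) u + pd k (fun v => hessForm ξ x v j l) u)

/-- The logarithmic derivative `q_{/i} / q` of the support function. -/
def logSupport (ξ y : Coord n → Coord (n + 1)) (u : Coord n) (i : Fin n) : ℝ :=
  (support ξ y u)⁻¹ * pd i (support ξ y) u

theorem IsMetricOn.isInvMetric {g : Coord n → Matrix (Fin n) (Fin n) ℝ} (h : IsMetricOn g U)
    (hu : u ∈ U) : IsInvMetric (g u)⁻¹ (g u) where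
  symm_inv := inv_symm (h.symm u hu)
  symm := h.symm u hu
  sum_mul := sum_inv_mul (h.det_ne_zero u hu)

theorem IsLocalHypersurface.isCubicForm_normalCubic (h : IsLocalHypersurface x ξ U)
    (hu : u ∈ U) : IsCubicForm (normalCubic x ξ u) := by
  have hh := h.isMetricOn_hessForm
  constructor
  · intro i j k
    simp only [normalCubic]
    rw [h.pd_pd_comm_right hu k j i, hh.pd_symm hu k i j]
    ring
  · intro i j k
    simp only [normalCubic]
    rw [h.pd_pd_comm_left hu k j i, hh.pd_symm hu i j k]
    ring

namespace IsLocalNormalization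

/-- The Darboux tensors of the normalizations of a hypersurface have, up to a factor, the same
traceless part. -/
theorem darboux_eq_normalCubic (h : IsLocalHypersurface x ξ U) (hy : IsLocalNormalization ξ y U)
    (hu : u ∈ U) (j k l : Fin n) : darboux x ξ y j k l u = (support ξ y u)⁻¹
      * (normalCubic x ξ u j k l + symProd (logSupport ξ y u) (hessForm ξ x u) j k l) := by
  have hq := hy.support_ne_zero u hu
  have dq : DifferentiableAt ℝ (support ξ y) u :=
    differentiableAt_of_contDiffOn (hy.contDiffOn_support h) h.isOpen hu (by norm_num)
  have dh : ∀ i j, DifferentiableAt ℝ (fun v => hessForm ξ x v i j) u := fun i j =>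
    differentiableAt_of_contDiffOn (h.isMetricOn_hessForm.contDiffOn i j) h.isOpen hu (by norm_num)
  have dqG : ∀ i j, DifferentiableAt ℝ (fun v => relMetric x ξ y v i j) u := fun i j =>
    differentiableAt_of_contDiffOn ((hy.isMetricOn h).contDiffOn i j) h.isOpen hu (by norm_num)
  have hG : ∀ v ∈ U, ∀ i j, hessForm ξ x v i j = support ξ y v * relMetric x ξ y v i j := by
    intro v hv i j
    rw [relMetric_eq, Matrix.smul_apply, smul_eq_mul, mul_inv_cancel_left₀
      (hy.support_ne_zero v hv)]
  have hpd : ∀ l i j, pd l (fun v => relMetric x ξ y v i j) u = (support ξ y u)⁻¹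
      * (pd l (fun v => hessForm ξ x v i j) u - logSupport ξ y u l * hessForm ξ x u i j) := by
    intro l i j
    rw [pd_congr h.isOpen (fun v hv => hG v hv i j) hu, pd_mul dq (dqG i j), hG u hu i j,
      logSupport]
    field_simp
    ring
  rw [hy.darboux_eq h hu, hpd, hpd, hpd, conormal, real_inner_smul_left, normalCubic, symProd]
  ring

theorem relMetric_inv_eq (h : IsLocalHypersurface x ξ U) (hy : IsLocalNormalization ξ y U)
    (hu : u ∈ U) : (relMetric x ξ y u)⁻¹ = support ξ y u • (hessForm ξ x u)⁻¹ := by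
  have hq := hy.support_ne_zero u hu
  refine Matrix.inv_eq_left_inv ?_
  rw [relMetric_eq, Matrix.smul_mul, Matrix.mul_smul, smul_smul, mul_inv_cancel₀ hq, one_smul,
    Matrix.nonsing_inv_mul _ (h.det_ne_zero u hu).isUnit]

end IsLocalNormalization

theorem affSupport_pos (h : IsLocalHypersurface x ξ U) (hu : u ∈ U) : 0 < affSupport x ξ u :=
  Real.rpow_pos_of_pos (abs_pos.2 (div_ne_zero (h.det_ne_zero u hu) (h.det_firstForm_ne_zero hu))) _

theorem affSupport_eq_exp (h : IsLocalHypersurface x ξ U) (hu : u ∈ U) :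
    affSupport x ξ u = Real.exp ((1 / ((n : ℝ) + 2))
      * (Real.log (hessForm ξ x u).det - Real.log (firstForm x u).det)) := by
  have h1 := h.det_ne_zero u hu
  have h2 := h.det_firstForm_ne_zero hu
  rw [affSupport, gaussCurv, Real.rpow_def_of_pos (abs_pos.2 (div_ne_zero h1 h2)), Real.log_abs,
    Real.log_div h1 h2, mul_comm]

theorem contDiffOn_affSupport (h : IsLocalHypersurface x ξ U) :
    ContDiffOn ℝ 2 (affSupport x ξ) U := by
  refine ContDiffOn.congr ?_ fun v hv => affSupport_eq_exp h hv
  exact Real.contDiff_exp.comp_contDiffOn (contDiffOn_const.mul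
    (((contDiffOn_det h.isMetricOn_hessForm.contDiffOn).log h.det_ne_zero).sub
      ((contDiffOn_det h.isMetricOn_firstForm.contDiffOn).log
        fun v hv => h.det_firstForm_ne_zero hv)))

theorem pd_log {f : Coord n → ℝ} (hf : DifferentiableAt ℝ f u) (h0 : f u ≠ 0) (i : Fin n) :
    pd i (fun v => Real.log (f v)) u = (f u)⁻¹ * pd i f u := by
  simp [pd, fderiv.log hf h0]

theorem pd_exp {f : Coord n → ℝ} (hf : DifferentiableAt ℝ f u) (i : Fin n) :
    pd i (fun v => Real.exp (f v)) u = Real.exp (f u) * pd i f u := by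
  simp [pd, fderiv_exp hf]

/-- The logarithmic derivative of the equiaffine support function, by Jacobi's formula. -/
theorem pd_affSupport (h : IsLocalHypersurface x ξ U) (hu : u ∈ U) (j : Fin n) :
    ((n : ℝ) + 2) * ((affSupport x ξ u)⁻¹ * pd j (affSupport x ξ) u)
      = (∑ k, ∑ l, (hessForm ξ x u)⁻¹ k l * pd j (fun v => hessForm ξ x v l k) u)
        - ∑ k, ∑ l, (firstForm x u)⁻¹ k l * pd j (fun v => firstForm x v l k) u := by
  have h1 := h.det_ne_zero u hu
  have h2 := h.det_firstForm_ne_zero hu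
  have d1 : ∀ i j, DifferentiableAt ℝ (fun v => hessForm ξ x v i j) u := fun i j =>
    differentiableAt_of_contDiffOn (h.isMetricOn_hessForm.contDiffOn i j) h.isOpen hu (by norm_num)
  have d2 : ∀ i j, DifferentiableAt ℝ (fun v => firstForm x v i j) u := fun i j =>
    differentiableAt_of_contDiffOn (h.isMetricOn_firstForm.contDiffOn i j) h.isOpen hu (by norm_num)
  have D1 : DifferentiableAt ℝ (fun v => (hessForm ξ x v).det) u :=
    differentiableAt_of_contDiffOn (contDiffOn_det h.isMetricOn_hessForm.contDiffOn) h.isOpen hu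
      (by norm_num)
  have D2 : DifferentiableAt ℝ (fun v => (firstForm x v).det) u :=
    differentiableAt_of_contDiffOn (contDiffOn_det h.isMetricOn_firstForm.contDiffOn) h.isOpen hu
      (by norm_num)
  have hpos := (affSupport_pos h hu).ne'
  have e1 : pd j (affSupport x ξ) u = affSupport x ξ u * ((1 / ((n : ℝ) + 2))
      * (((hessForm ξ x u).det)⁻¹ * pd j (fun v => (hessForm ξ x v).det) u
        - ((firstForm x u).det)⁻¹ * pd j (fun v => (firstForm x v).det) u)) := by
    rw [pd_congr h.isOpen (fun v hv => affSupport_eq_exp h hv) hu,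
      pd_exp ((differentiableAt_const _).fun_mul ((D1.log h1).fun_sub (D2.log h2))),
      ← affSupport_eq_exp h hu, pd_mul (differentiableAt_const _) ((D1.log h1).fun_sub (D2.log h2)),
      pd_const, pd_sub (D1.log h1) (D2.log h2), pd_log D1 h1, pd_log D2 h2, zero_mul, zero_add]
  rw [e1, pd_det d1 h1, pd_det d2 h2, inv_mul_cancel_left₀ h1, inv_mul_cancel_left₀ h2,
    inv_mul_cancel_left₀ hpos]
  field_simp

theorem pd_normal_eq (h : IsLocalHypersurface x ξ U) (hu : u ∈ U) (l : Fin n) :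
    pd l ξ u = -∑ m, (∑ r, hessForm ξ x u l r * (firstForm x u)⁻¹ r m) • pd m x u := by
  have dξ : DifferentiableAt ℝ ξ u :=
    differentiableAt_of_contDiffOn h.contDiffOn_normal h.isOpen hu (by norm_num)
  have h1 : inner ℝ (ξ u) (pd l ξ u) = 0 := by
    have h2 : pd l (fun v => (inner ℝ (ξ v) (ξ v) : ℝ)) u = 0 := by
      rw [pd_congr h.isOpen (g := fun _ => (1 : ℝ)) (fun v hv => by
        rw [real_inner_self_eq_norm_sq, h.norm_normal v hv, one_pow]) hu, pd_const]
    rw [pd_inner dξ dξ, real_inner_comm] at h2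
    linarith
  rw [RelGeom.pd_eq_shapeOp x ξ u (h.linearIndependent u hu) l
    (mem_span_pd_of_inner_eq_zero (h.linearIndependent u hu) (h.norm_normal u hu) (h.normal u hu)
      h1)]
  congr 1
  refine Finset.sum_congr rfl fun m _ => ?_
  congr 1
  simp only [shapeOp, Matrix.of_apply, ← Finset.sum_neg_distrib]
  refine Finset.sum_congr rfl fun r _ => ?_
  rw [h.inner_pd_pd h.contDiffOn_normal h.normal hu, h.isMetricOn_hessForm.symm u hu r l]
  ring

/-- The trace of the cubic form of the Euclidean normalization is
`-(log |det h| - log det g)_{/j} / 2`. -/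
theorem cubicTrace_normalCubic (h : IsLocalHypersurface x ξ U) (hu : u ∈ U) (j : Fin n) :
    cubicTrace (hessForm ξ x u)⁻¹ (normalCubic x ξ u) j
      = -(1 / 2) * ((∑ k, ∑ l, (hessForm ξ x u)⁻¹ k l * pd j (fun v => hessForm ξ x v l k) u)
        - ∑ k, ∑ l, (firstForm x u)⁻¹ k l * pd j (fun v => firstForm x v l k) u) := by
  have hh := h.isMetricOn_hessForm
  have hg := h.isMetricOn_firstForm
  have qs := inv_symm (hh.symm u hu)
  have gs := inv_symm (hg.symm u hu)
  have dx : ∀ i, DifferentiableAt ℝ (pd i x) u := fun i =>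
    differentiableAt_of_contDiffOn (h.contDiffOn_pd i) h.isOpen hu (by norm_num)
  have hpd : ∀ l i k, pd l (fun v => hessForm ξ x v i k) u
      = inner ℝ (pd l ξ u) (pd k (pd i x) u) + inner ℝ (ξ u) (pd l (pd k (pd i x)) u) :=
    fun l i k => pd_inner
      (differentiableAt_of_contDiffOn h.contDiffOn_normal h.isOpen hu (by norm_num))
      (differentiableAt_of_contDiffOn (h.contDiffOn_pd_pd k i) h.isOpen hu (by norm_num)) l
  have hC : ∀ k l, normalCubic x ξ u j k l = -(1 / 2) * (pd j (fun v => hessForm ξ x v l k) u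
      + (inner ℝ (pd l ξ u) (pd j (pd k x) u) + inner ℝ (pd k ξ u) (pd j (pd l x) u))) := by
    intro k l
    rw [normalCubic, hh.pd_symm hu j k l, hpd l j k, hpd k j l, h.pd_pd_comm_left hu k l j,
      h.pd_comm hu k j, h.pd_comm hu l j]
    ring
  -- the Weingarten equation turns the trace with respect to `h` into one with respect to `g`
  have hW : ∑ k, ∑ l, (hessForm ξ x u)⁻¹ k l * inner ℝ (pd l ξ u) (pd j (pd k x) u)
      = -∑ k, ∑ m, (firstForm x u)⁻¹ k m * inner ℝ (pd m x u) (pd j (pd k x) u) := by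
    rw [← Finset.sum_neg_distrib]
    refine Finset.sum_congr rfl fun k _ => ?_
    have : ∀ l, (inner ℝ (pd l ξ u) (pd j (pd k x) u) : ℝ) = -∑ r, hessForm ξ x u l r
        * ∑ m, (firstForm x u)⁻¹ r m * inner ℝ (pd m x u) (pd j (pd k x) u) := by
      intro l
      rw [pd_normal_eq h hu, inner_neg_left, sum_inner]
      simp only [real_inner_smul_left, Finset.sum_mul, Finset.mul_sum]
      rw [Finset.sum_comm]
      simp only [mul_assoc]
    simp only [this, mul_neg, Finset.sum_neg_distrib]
    rw [sum_inv_mul_sum (h.det_ne_zero u hu)]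
  have hW' : ∑ k, ∑ l, (hessForm ξ x u)⁻¹ k l * inner ℝ (pd k ξ u) (pd j (pd l x) u)
      = -∑ k, ∑ m, (firstForm x u)⁻¹ k m * inner ℝ (pd m x u) (pd j (pd k x) u) := by
    rw [← hW, Finset.sum_comm]
    exact Finset.sum_congr rfl fun k _ => Finset.sum_congr rfl fun l _ => by rw [qs]
  have hg' : ∑ k, ∑ l, (firstForm x u)⁻¹ k l * pd j (fun v => firstForm x v l k) u
      = 2 * ∑ k, ∑ m, (firstForm x u)⁻¹ k m * inner ℝ (pd m x u) (pd j (pd k x) u) := by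
    have e : ∀ k l, pd j (fun v => firstForm x v l k) u
        = inner ℝ (pd k x u) (pd j (pd l x) u) + inner ℝ (pd l x u) (pd j (pd k x) u) := by
      intro k l
      rw [← real_inner_comm]
      exact pd_inner (dx l) (dx k) j
    simp only [e, mul_add, Finset.sum_add_distrib]
    rw [two_mul]
    congr 1
    rw [Finset.sum_comm]
    exact Finset.sum_congr rfl fun k _ => Finset.sum_congr rfl fun l _ => by rw [gs]
  have : cubicTrace (hessForm ξ x u)⁻¹ (normalCubic x ξ u) j
      = -(1 / 2) * ((∑ k, ∑ l, (hessForm ξ x u)⁻¹ k l * pd j (fun v => hessForm ξ x v l k) u)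
        + ((∑ k, ∑ l, (hessForm ξ x u)⁻¹ k l * inner ℝ (pd l ξ u) (pd j (pd k x) u))
          + ∑ k, ∑ l, (hessForm ξ x u)⁻¹ k l * inner ℝ (pd k ξ u) (pd j (pd l x) u))) := by
    simp only [cubicTrace, hC, Finset.mul_sum, ← Finset.sum_add_distrib]
    iterate 2 refine Finset.sum_congr rfl fun _ _ => ?_
    ring
  rw [this, hW, hW', hg']
  ring

variable {yA : Coord n → Coord (n + 1)}

/-- The Darboux tensor of the equiaffine normalization is traceless (apolarity). -/
theorem cubicTrace_equiaffine (h : IsLocalHypersurface x ξ U)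
    (hq : ∀ v ∈ U, support ξ yA v = affSupport x ξ v) (hu : u ∈ U) (j : Fin n) :
    cubicTrace (hessForm ξ x u)⁻¹ (fun j k l => normalCubic x ξ u j k l
      + symProd (logSupport ξ yA u) (hessForm ξ x u) j k l) j = 0 := by
  have h1 := pd_affSupport h hu j
  have h2 := cubicTrace_normalCubic h hu j
  rw [cubicTrace_add, (h.isMetricOn_hessForm.isInvMetric hu).cubicTrace_symProd, logSupport,
    hq u hu, pd_congr h.isOpen hq hu, h2, ← h1]
  ring

/-- The invariant is the squared norm of the traceless part of the cubic form of the Euclidean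
normalization; this traceless part is represented by means of the equiaffine support function. -/
theorem relFun_eq_cubicInner (h : IsLocalHypersurface x ξ U) (hy : IsLocalNormalization ξ y U)
    (hq : ∀ v ∈ U, support ξ yA v = affSupport x ξ v) (hu : u ∈ U) (hn : 2 ≤ n) :
    relFun x ξ y u = 1 / ((n : ℝ) * (n - 1)) * (((n : ℝ) + 2)
      * cubicInner (hessForm ξ x u)⁻¹
        (fun j k l => normalCubic x ξ u j k l
          + symProd (logSupport ξ yA u) (hessForm ξ x u) j k l)
        (fun j k l => normalCubic x ξ u j k l
          + symProd (logSupport ξ yA u) (hessForm ξ x u) j k l)) := by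
  have hI := h.isMetricOn_hessForm.isInvMetric hu
  have hq0 := hy.support_ne_zero u hu
  have hA : (fun j k l => darboux x ξ y j k l u) = fun j k l => (support ξ y u)⁻¹ *
      ((normalCubic x ξ u j k l + symProd (logSupport ξ yA u) (hessForm ξ x u) j k l)
        + symProd (fun i => logSupport ξ y u i - logSupport ξ yA u i) (hessForm ξ x u) j k l) := by
    funext j k l
    rw [hy.darboux_eq_normalCubic h hu]
    simp only [symProd]
    ring
  have key := hI.cubicInner_add_symProd
    ((h.isCubicForm_normalCubic hu).add (hI.isCubicForm_symProd _))
    (cubicTrace_equiaffine h hq hu) (fun i => logSupport ξ y u i - logSupport ξ yA u i)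
  rw [hy.relFun_eq h hu hn, hA, hy.relMetric_inv_eq h hu, cubicInner_smul, ← key]
  simp only [cubicTrace_smul, mul_inv_cancel₀ hq0, one_mul, Matrix.smul_apply, smul_eq_mul,
    mul_assoc, ← Finset.mul_sum]
  field_simp

theorem pick_equiaffine (h : IsLocalHypersurface x ξ U) (hyA : IsLocalNormalization ξ yA U)
    (hu : u ∈ U) : pick x ξ yA u = 1 / ((n : ℝ) * (n - 1)) * (support ξ yA u
      * cubicInner (hessForm ξ x u)⁻¹
        (fun j k l => normalCubic x ξ u j k l
          + symProd (logSupport ξ yA u) (hessForm ξ x u) j k l)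
        (fun j k l => normalCubic x ξ u j k l
          + symProd (logSupport ξ yA u) (hessForm ξ x u) j k l)) := by
  have hq0 := hyA.support_ne_zero u hu
  have hJ : pick x ξ yA u = 1 / ((n : ℝ) * (n - 1))
      * cubicInner (relMetric x ξ yA u)⁻¹ (fun i j k => darboux x ξ yA i j k u)
          (fun i j k => darboux x ξ yA i j k u) := rfl
  rw [hJ]
  simp only [hyA.darboux_eq_normalCubic h hu]
  rw [hyA.relMetric_inv_eq h hu, cubicInner_smul]
  field_simp

theorem relFun_eq_pick (h : IsLocalHypersurface x ξ U) (hy : IsLocalNormalization ξ y U)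
    (hyA : IsLocalNormalization ξ yA U) (hq : ∀ v ∈ U, support ξ yA v = affSupport x ξ v)
    (hu : u ∈ U) (hn : 2 ≤ n) :
    relFun x ξ y u = ((n : ℝ) + 2) * pick x ξ yA u / affSupport x ξ u := by
  have hq0 := hyA.support_ne_zero u hu
  rw [relFun_eq_cubicInner h hy hq hu hn, pick_equiaffine h hyA hu, ← hq u hu]
  field_simp

end Equiaffine

/-! ### Construction of a normalization from its support function -/

section LocalConstruction

variable {n : ℕ} {U : Set (Coord n)} {u : Coord n} {x ξ y : Coord n → Coord (n + 1)}

/-- A continuous unit normal field is of class `C²`: locally it is the normalization of the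
projection of a constant vector to the normal space. -/
theorem contDiffOn_of_unit_normal (hU : IsOpen U) (hx : ContDiffOn ℝ 4 x U)
    (hli : ∀ v ∈ U, LinearIndependent ℝ fun i => pd i x v) (hξ : ContinuousOn ξ U)
    (h1 : ∀ v ∈ U, ‖ξ v‖ = 1) (hn : ∀ v ∈ U, ∀ i, inner ℝ (ξ v) (pd i x v) = 0) :
    ContDiffOn ℝ 2 ξ U := by
  intro u hu
  refine ContDiffAt.contDiffWithinAt ?_
  have hdet : ∀ v ∈ U, (firstForm x v).det ≠ 0 := fun v hv =>
    (Matrix.posDef_gram_of_linearIndependent (hli v hv)).det_pos.ne'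
  have hpd : ∀ i, ContDiffOn ℝ 2 (pd i x) U := fun i => contDiffOn_pd hx hU (by norm_num) i
  let N : Coord n → Coord (n + 1) := fun v =>
    ξ u - ∑ j, (∑ i, (firstForm x v)⁻¹ j i * inner ℝ (ξ u) (pd i x v)) • pd j x v
  have hN : ContDiffOn ℝ 2 N U := by
    have hc : ∀ j, ContDiffOn ℝ 2
        (fun v => ∑ i, (firstForm x v)⁻¹ j i * inner ℝ (ξ u) (pd i x v)) U := fun j =>
      ContDiffOn.sum fun i _ =>
        (contDiffOn_inv (fun a b => (hpd a).inner ℝ (hpd b)) hdet j i).mul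
          (contDiffOn_const.inner ℝ (hpd i))
    exact contDiffOn_const.sub (ContDiffOn.sum fun j _ => (hc j).smul (hpd j))
  have hNx : ∀ v ∈ U, ∀ k, inner ℝ (N v) (pd k x v) = 0 := by
    intro v hv k
    have := sum_mul_sum_inv (hdet v hv) (fun i => inner ℝ (ξ u) (pd i x v)) k
    simp only [N, inner_sub_left, sum_inner, real_inner_smul_left]
    rw [sub_eq_zero, ← this]
    refine Finset.sum_congr rfl fun m _ => ?_
    rw [mul_comm, real_inner_comm]
    rfl
  -- the normal space is one-dimensional
  have hNξ : ∀ v ∈ U, N v = (inner ℝ (ξ v) (ξ u) : ℝ) • ξ v := by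
    intro v hv
    have hξN : (inner ℝ (ξ v) (N v) : ℝ) = inner ℝ (ξ v) (ξ u) := by
      simp [N, inner_sub_right, inner_sum, real_inner_smul_right, hn v hv]
    have hw : inner ℝ (ξ v) (N v - (inner ℝ (ξ v) (ξ u) : ℝ) • ξ v) = 0 := by
      rw [inner_sub_right, real_inner_smul_right, real_inner_self_eq_norm_sq, h1 v hv, hξN]
      ring
    obtain ⟨c, hc⟩ := (Submodule.mem_span_range_iff_exists_fun ℝ).1
      (mem_span_pd_of_inner_eq_zero (hli v hv) (h1 v hv) (hn v hv) hw)
    rw [← sub_eq_zero, ← inner_self_eq_zero (𝕜 := ℝ)]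
    nth_rw 2 [← hc]
    simp [inner_sum, real_inner_smul_right, inner_sub_left, real_inner_smul_left, hNx v hv,
      hn v hv]
  have hcont : ContinuousAt (fun v => (inner ℝ (ξ v) (ξ u) : ℝ)) u :=
    (hξ.continuousAt (hU.mem_nhds hu)).inner continuousAt_const
  have hu1 : (inner ℝ (ξ u) (ξ u) : ℝ) = 1 := by
    rw [real_inner_self_eq_norm_sq, h1 u hu, one_pow]
  have hpos : ∀ᶠ v in nhds u, 0 < (inner ℝ (ξ v) (ξ u) : ℝ) :=
    hcont.eventually_const_lt (zero_lt_one.trans_eq hu1.symm)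
  have hNu : N u ≠ 0 := by
    rw [hNξ u hu, hu1, one_smul]
    intro h0
    have := h1 u hu
    simp [h0] at this
  have hNat := hN.contDiffAt (hU.mem_nhds hu)
  have : ContDiffAt ℝ 2 (fun v => ‖N v‖⁻¹ • N v) u :=
    ((hNat.norm ℝ hNu).inv (norm_ne_zero_iff.2 hNu)).smul hNat
  refine this.congr_of_eventuallyEq ?_
  filter_upwards [hpos, hU.mem_nhds hu] with v hv hvU
  rw [hNξ v hvU, norm_smul, h1 v hvU, mul_one, Real.norm_of_nonneg hv.le, smul_smul,
    inv_mul_cancel₀ hv.ne', one_smul]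

/-- The Euclidean normalization is a relative normalization. -/
theorem IsLocalHypersurface.isLocalNormalization_normal (h : IsLocalHypersurface x ξ U) :
    IsLocalNormalization ξ ξ U where
  contDiffOn := h.contDiffOn_normal.of_le (by norm_num)
  support_ne_zero v hv := by
    rw [support, real_inner_self_eq_norm_sq, h.norm_normal v hv]
    norm_num
  inner_pd v hv i := by
    rw [pd_normal_eq h hv, inner_neg_right, inner_sum]
    simp [real_inner_smul_right, h.normal v hv]

theorem IsLocalHypersurface.eq_of_inner_normal (h : IsLocalHypersurface x ξ U) (hu : u ∈ U)
    {w w' : Coord (n + 1)} (h0 : (inner ℝ (ξ u) w : ℝ) = inner ℝ (ξ u) w')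
    (h1 : ∀ p, (inner ℝ (pd p ξ u) w : ℝ) = inner ℝ (pd p ξ u) w') : w = w' := by
  have hc : ∀ v ∈ U, conormal ξ ξ v = ξ v := fun v hv => by
    rw [conormal, support, real_inner_self_eq_norm_sq, h.norm_normal v hv]
    simp
  rw [← sub_eq_zero]
  refine h.isLocalNormalization_normal.eq_zero_of_inner_conormal h hu ?_ fun p => ?_
  · rw [hc u hu, inner_sub_right, h0, sub_self]
  · rw [pd_congr h.isOpen hc hu, inner_sub_right, h1, sub_self]

/-- A relative normalization is determined by its support function. -/
theorem IsLocalNormalization.eq_of_support_eq {y' : Coord n → Coord (n + 1)}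
    (h : IsLocalHypersurface x ξ U) (hy : IsLocalNormalization ξ y U)
    (hy' : IsLocalNormalization ξ y' U) (hq : ∀ v ∈ U, support ξ y v = support ξ y' v)
    (hu : u ∈ U) : y u = y' u := by
  refine h.eq_of_inner_normal hu (hq u hu) fun p => ?_
  rw [← hy.pd_support h hu, ← hy'.pd_support h hu, pd_congr h.isOpen hq hu]

/-- The relative normalization with support function `q`,
`y = q ξ - h^{ki} q_{/i} x_{/k}`. -/
def normalizationOf (x ξ : Coord n → Coord (n + 1)) (q : Coord n → ℝ) (u : Coord n) :
    Coord (n + 1) :=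
  q u • ξ u - ∑ k, (∑ i, (hessForm ξ x u)⁻¹ k i * pd i q u) • pd k x u

variable {q : Coord n → ℝ}

theorem inner_normal_normalizationOf (h : IsLocalHypersurface x ξ U) (hu : u ∈ U) :
    inner ℝ (ξ u) (normalizationOf x ξ q u) = q u := by
  simp [normalizationOf, inner_sub_right, inner_sum, real_inner_smul_right, h.normal u hu,
    h.norm_normal u hu]

theorem inner_pd_normal_normalizationOf (h : IsLocalHypersurface x ξ U) (hu : u ∈ U) (p : Fin n) :
    inner ℝ (pd p ξ u) (normalizationOf x ξ q u) = pd p q u := by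
  have h1 : inner ℝ (pd p ξ u) (ξ u) = 0 := by
    rw [real_inner_comm]
    exact h.isLocalNormalization_normal.inner_pd u hu p
  simp only [normalizationOf, inner_sub_right, inner_sum, real_inner_smul_right, h1, mul_zero,
    h.inner_pd_pd h.contDiffOn_normal h.normal hu, mul_neg, Finset.sum_neg_distrib, zero_sub,
    neg_neg]
  rw [← sum_mul_sum_inv (h.det_ne_zero u hu) (fun i => pd i q u) p]
  refine Finset.sum_congr rfl fun k _ => ?_
  rw [h.isMetricOn_hessForm.symm u hu k p, mul_comm]

theorem isLocalNormalization_normalizationOf (h : IsLocalHypersurface x ξ U)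
    (hq : ContDiffOn ℝ 2 q U) (hq0 : ∀ v ∈ U, q v ≠ 0) :
    IsLocalNormalization ξ (normalizationOf x ξ q) U := by
  have hc : ContDiffOn ℝ 1 (normalizationOf x ξ q) U := by
    have h1 : ∀ k, ContDiffOn ℝ 1 (fun v => ∑ i, (hessForm ξ x v)⁻¹ k i * pd i q v) U := fun k =>
      ContDiffOn.sum fun i _ =>
        ((h.isMetricOn_hessForm.contDiffOn_inv k i).of_le (by norm_num)).mul
          (contDiffOn_pd hq h.isOpen (by norm_num) i)
    have h2 : ∀ k, ContDiffOn ℝ 1 (pd k x) U := fun k => (h.contDiffOn_pd k).of_le (by norm_num)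
    exact ((hq.smul h.contDiffOn_normal).of_le (by norm_num)).sub
      (ContDiffOn.sum fun k _ => (h1 k).smul (h2 k))
  refine ⟨hc, fun v hv => ?_, fun v hv i => ?_⟩
  · rw [support, inner_normal_normalizationOf h hv]
    exact hq0 v hv
  · have h1 : pd i (fun v => (inner ℝ (ξ v) (normalizationOf x ξ q v) : ℝ)) v = pd i q v :=
      pd_congr h.isOpen (fun w hw => inner_normal_normalizationOf h hw) hv i
    rw [pd_inner (differentiableAt_of_contDiffOn h.contDiffOn_normal h.isOpen hv (by norm_num))
      (differentiableAt_of_contDiffOn hc h.isOpen hv (by norm_num)),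
      inner_pd_normal_normalizationOf h hv] at h1
    linarith

end LocalConstruction

/-! ### Change of coordinates -/

section ChangeOfCoordinates

variable {n : ℕ} {U U' W : Set (Coord n)} {u : Coord n} {x ξ x' ξ' : Coord n → Coord (n + 1)}
  {φ : Coord n → Coord n}

theorem pd_comp {V : Type*} [NormedAddCommGroup V] [NormedSpace ℝ V] {f : Coord n → V}
    (hf : DifferentiableAt ℝ f (φ u)) (hφ : DifferentiableAt ℝ φ u) (i : Fin n) :
    pd i (fun v => f (φ v)) u = ∑ a, pd i φ u a • pd a f (φ u) := by
  have : fderiv ℝ (fun v => f (φ v)) u = (fderiv ℝ f (φ u)).comp (fderiv ℝ φ u) :=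
    fderiv_comp u hf hφ
  rw [pd, this, ContinuousLinearMap.comp_apply, fderiv_eq_sum_pd]
  rfl

/-- Two coordinate expressions of a hypersurface, related on `W` by the change of coordinates
`φ`. -/
structure IsCoordChange (x ξ x' ξ' : Coord n → Coord (n + 1)) (U U' W : Set (Coord n))
    (φ : Coord n → Coord n) : Prop where
  source : IsLocalHypersurface x ξ U
  target : IsLocalHypersurface x' ξ' U'
  isOpen : IsOpen W
  subset : W ⊆ U
  mapsTo : ∀ v ∈ W, φ v ∈ U'
  differentiableAt : ∀ v ∈ W, DifferentiableAt ℝ φ v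
  eq_position : ∀ v ∈ W, x v = x' (φ v)
  eq_normal : ∀ v ∈ W, ξ v = ξ' (φ v)

namespace IsCoordChange

theorem pd_position (h : IsCoordChange x ξ x' ξ' U U' W φ) (hu : u ∈ W) (i : Fin n) :
    pd i x u = ∑ a, pd i φ u a • pd a x' (φ u) := by
  rw [pd_congr h.isOpen h.eq_position hu]
  exact pd_comp (differentiableAt_of_contDiffOn h.target.contDiffOn h.target.isOpen
    (h.mapsTo u hu) (by norm_num)) (h.differentiableAt u hu) i

theorem pd_normal (h : IsCoordChange x ξ x' ξ' U U' W φ) (hu : u ∈ W) (i : Fin n) :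
    pd i ξ u = ∑ a, pd i φ u a • pd a ξ' (φ u) := by
  rw [pd_congr h.isOpen h.eq_normal hu]
  exact pd_comp (differentiableAt_of_contDiffOn h.target.contDiffOn_normal h.target.isOpen
    (h.mapsTo u hu) (by norm_num)) (h.differentiableAt u hu) i

/-- The Gaussian curvature does not depend on the coordinates: both fundamental forms are
transformed by the same congruence. -/
theorem gaussCurv_eq (h : IsCoordChange x ξ x' ξ' U U' W φ) (hu : u ∈ W) :
    gaussCurv x ξ u = gaussCurv x' ξ' (φ u) := by
  let P : Matrix (Fin n) (Fin n) ℝ := Matrix.of fun i a => pd i φ u a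
  have hg : firstForm x u = P * firstForm x' (φ u) * P.transpose := by
    ext i j
    simp only [firstForm, Matrix.of_apply, h.pd_position hu, sum_inner, inner_sum,
      real_inner_smul_left, real_inner_smul_right, Matrix.mul_apply, Matrix.transpose_apply, P,
      Finset.sum_mul]
    iterate 2 refine Finset.sum_congr rfl fun _ _ => ?_
    ring
  have hh : hessForm ξ x u = P * hessForm ξ' x' (φ u) * P.transpose := by
    ext i j
    have e : ∀ {x ξ : Coord n → Coord (n + 1)} {U : Set (Coord n)} {u : Coord n},
        IsLocalHypersurface x ξ U → u ∈ U → ∀ i j,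
        hessForm ξ x u i j = -inner ℝ (pd j ξ u) (pd i x u) := by
      intro x ξ U u h hu i j
      rw [h.inner_pd_pd h.contDiffOn_normal h.normal hu, neg_neg]
    simp only [e h.source (h.subset hu), e h.target (h.mapsTo u hu), h.pd_position hu,
      h.pd_normal hu, sum_inner, inner_sum, real_inner_smul_left, real_inner_smul_right,
      Matrix.mul_apply, Matrix.transpose_apply, P, Matrix.of_apply, Finset.sum_mul,
      ← Finset.sum_neg_distrib]
    rw [Finset.sum_comm]
    iterate 2 refine Finset.sum_congr rfl fun _ _ => ?_
    ring
  have hP : P.det ≠ 0 := by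
    intro h0
    apply h.source.det_firstForm_ne_zero (h.subset hu)
    rw [hg, Matrix.det_mul, Matrix.det_mul, h0, zero_mul, zero_mul]
  have hg0 := h.target.det_firstForm_ne_zero (h.mapsTo u hu)
  rw [gaussCurv, gaussCurv, hg, hh]
  simp only [Matrix.det_mul, Matrix.det_transpose]
  field_simp

theorem affSupport_eq (h : IsCoordChange x ξ x' ξ' U U' W φ) (hu : u ∈ W) :
    affSupport x ξ u = affSupport x' ξ' (φ u) := by
  rw [affSupport, affSupport, h.gaussCurv_eq hu]

/-- The equiaffine normalization does not depend on the coordinates. -/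
theorem normalizationOf_affSupport_eq (h : IsCoordChange x ξ x' ξ' U U' W φ) (hu : u ∈ W) :
    normalizationOf x ξ (affSupport x ξ) u = normalizationOf x' ξ' (affSupport x' ξ') (φ u) := by
  have hu' := h.mapsTo u hu
  refine h.source.eq_of_inner_normal (h.subset hu) ?_ fun p => ?_
  · rw [inner_normal_normalizationOf h.source (h.subset hu), h.eq_normal u hu,
      inner_normal_normalizationOf h.target hu', h.affSupport_eq hu]
  · rw [inner_pd_normal_normalizationOf h.source (h.subset hu), h.pd_normal hu,
      pd_congr h.isOpen (fun v hv => h.affSupport_eq hv) hu,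
      pd_comp (differentiableAt_of_contDiffOn (contDiffOn_affSupport h.target) h.target.isOpen hu'
        (by norm_num)) (h.differentiableAt u hu) p, sum_inner]
    simp only [real_inner_smul_left, inner_pd_normal_normalizationOf h.target hu', smul_eq_mul]

end IsCoordChange

end ChangeOfCoordinates

/-! ### Passage to charts -/

section Charts

variable {n : ℕ} {r : WithTop ℕ∞} {M : Type*} [TopologicalSpace M] [ChartedSpace (Coord n) M]
  {x ξ y : M → Coord (n + 1)} {e e' : OpenPartialHomeomorph M (Coord n)}

/-- The coordinate expression of a map of class `C^k`. -/
theorem contDiffOn_comp_symm [IsManifold (𝓡 n) r M] {k : WithTop ℕ∞} (hk : k ≤ r) {m : ℕ}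
    {f : M → Coord m} (hf : ContMDiff (𝓡 n) 𝓘(ℝ, Coord m) k f)
    (he : e ∈ IsManifold.maximalAtlas (𝓡 n) r M) : ContDiffOn ℝ k (f ∘ e.symm) e.target :=
  (hf.comp_contMDiffOn ((contMDiffOn_symm_of_mem_maximalAtlas he).of_le hk)).contDiffOn

theorem IsHypersurface.isLocalHypersurface [IsManifold (𝓡 n) r M] (hr : 4 ≤ r)
    (hx : IsHypersurface r x ξ) (he : e ∈ IsManifold.maximalAtlas (𝓡 n) r M) :
    IsLocalHypersurface (x ∘ e.symm) (ξ ∘ e.symm) e.target where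
  isOpen := e.open_target
  contDiffOn := contDiffOn_comp_symm hr (hx.contMDiff.of_le hr) he
  linearIndependent := hx.immersion e he
  contDiffOn_normal := contDiffOn_of_unit_normal e.open_target
    (contDiffOn_comp_symm hr (hx.contMDiff.of_le hr) he) (hx.immersion e he)
    (hx.continuous_normal.comp_continuousOn e.continuousOn_symm) (fun _ _ => hx.norm_normal _)
    (hx.normal e he)
  norm_normal _ _ := hx.norm_normal _
  normal := hx.normal e he
  det_ne_zero v hv h0 := hx.gaussCurv_ne_zero e he v hv (by rw [gaussCurv, h0, zero_div])

theorem IsRelNormalization.isLocalNormalization [IsManifold (𝓡 n) r M] (hr : 4 ≤ r)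
    (hx : IsHypersurface r x ξ) (hy : IsRelNormalization r x y)
    (he : e ∈ IsManifold.maximalAtlas (𝓡 n) r M) :
    IsLocalNormalization (ξ ∘ e.symm) (y ∘ e.symm) e.target := by
  have h := hx.isLocalHypersurface hr he
  have hfin : ∀ v ∈ e.target, Module.finrank ℝ
      (Submodule.span ℝ (Set.range fun i => pd i (x ∘ e.symm) v)) = n := fun v hv => by
    rw [finrank_span_eq_card (h.linearIndependent v hv), Fintype.card_fin]
  have hperp : ∀ v ∈ e.target, ∀ w ∈ Submodule.span ℝ (Set.range fun i => pd i (x ∘ e.symm) v),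
      inner ℝ ((ξ ∘ e.symm) v) w = 0 := by
    intro v hv w hw
    obtain ⟨c, rfl⟩ := (Submodule.mem_span_range_iff_exists_fun ℝ).1 hw
    simp [inner_sum, real_inner_smul_right, h.normal v hv, -Function.comp_apply]
  refine ⟨contDiffOn_comp_symm (le_trans (by norm_num) hr) hy.contMDiff he, fun v hv h0 => ?_,
    fun v hv i => hperp v hv _ ?_⟩
  · have hmem : y (e.symm v) ∈ _ := mem_span_pd_of_inner_eq_zero (h.linearIndependent v hv)
      (h.norm_normal v hv) (h.normal v hv) h0
    have h1 := hy.rank_self e he v hv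
    rw [Set.finrank, Submodule.span_insert_eq_span hmem, hfin v hv] at h1
    omega
  · have h1 := hy.rank_pd e he v hv i
    have hle : Submodule.span ℝ (Set.range fun j => pd j (x ∘ e.symm) v) ≤ Submodule.span ℝ
        (insert (pd i (y ∘ e.symm) v) (Set.range fun j => pd j (x ∘ e.symm) v)) :=
      Submodule.span_mono (Set.subset_insert _ _)
    rw [Submodule.eq_of_le_of_finrank_eq hle ((hfin v hv).trans h1.symm)]
    exact Submodule.subset_span (Set.mem_insert _ _)

/-- A map of class `C¹` is a relative normalization if its support function vanishes nowhere and
its derivatives are tangential. -/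
theorem isRelNormalization_of_isLocalNormalization [IsManifold (𝓡 n) r M] (hr : 4 ≤ r)
    (hx : IsHypersurface r x ξ) (hy : ∀ e ∈ IsManifold.maximalAtlas (𝓡 n) r M,
      IsLocalNormalization (ξ ∘ e.symm) (y ∘ e.symm) e.target) : IsRelNormalization r x y where
  contMDiff p := by
    have he : chartAt (Coord n) p ∈ IsManifold.maximalAtlas (𝓡 n) r M :=
      IsManifold.chart_mem_maximalAtlas p
    have hp : p ∈ (chartAt (Coord n) p).source := mem_chart_source _ p
    have h1 : ContMDiffOn (𝓡 n) 𝓘(ℝ, Coord (n + 1)) 1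
        ((y ∘ (chartAt (Coord n) p).symm) ∘ chartAt (Coord n) p) (chartAt (Coord n) p).source :=
      (hy _ he).contDiffOn.contMDiffOn.comp
        ((contMDiffOn_of_mem_maximalAtlas he).of_le (le_trans (by norm_num) hr))
        (chartAt (Coord n) p).mapsTo
    refine (h1.congr fun v hv => ?_).contMDiffAt ((chartAt (Coord n) p).open_source.mem_nhds hp)
    simp [(chartAt (Coord n) p).left_inv hv]
  rank_self e he u hu := by
    have h := hx.isLocalHypersurface hr he
    have htop : Submodule.span ℝ
        (insert (y (e.symm u)) (Set.range fun i => pd i (x ∘ e.symm) u)) = ⊤ := by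
      refine Submodule.eq_top_iff'.2 fun w => ?_
      have hq : inner ℝ ((ξ ∘ e.symm) u) (y (e.symm u)) ≠ 0 := (hy e he).support_ne_zero u hu
      have h1 := mem_span_pd_of_inner_eq_zero (h.linearIndependent u hu) (h.norm_normal u hu)
        (h.normal u hu) (w := w - (inner ℝ ((ξ ∘ e.symm) u) w
          / inner ℝ ((ξ ∘ e.symm) u) (y (e.symm u))) • y (e.symm u)) (by
          rw [inner_sub_right, real_inner_smul_right, div_mul_cancel₀ _ hq, sub_self])
      exact Submodule.mem_span_insert.2 ⟨_, _, h1, (add_sub_cancel _ _).symm⟩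
    rw [Set.finrank, htop, finrank_top]
    simp
  rank_pd e he u hu i := by
    have h := hx.isLocalHypersurface hr he
    have hmem := mem_span_pd_of_inner_eq_zero (h.linearIndependent u hu) (h.norm_normal u hu)
      (h.normal u hu) ((hy e he).inner_pd u hu i)
    rw [Set.finrank, Submodule.span_insert_eq_span hmem,
      finrank_span_eq_card (h.linearIndependent u hu), Fintype.card_fin]

theorem IsHypersurface.isCoordChange [IsManifold (𝓡 n) r M] (hr : 4 ≤ r)
    (hx : IsHypersurface r x ξ) (he : e ∈ IsManifold.maximalAtlas (𝓡 n) r M)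
    (he' : e' ∈ IsManifold.maximalAtlas (𝓡 n) r M) :
    IsCoordChange (x ∘ e.symm) (ξ ∘ e.symm) (x ∘ e'.symm) (ξ ∘ e'.symm) e.target e'.target
      (e.symm.trans e').source (e.symm.trans e') where
  source := hx.isLocalHypersurface hr he
  target := hx.isLocalHypersurface hr he'
  isOpen := (e.symm.trans e').open_source
  subset v hv := by
    simp only [OpenPartialHomeomorph.trans_source] at hv
    exact hv.1
  mapsTo v hv := by
    simp only [OpenPartialHomeomorph.trans_source] at hv
    exact e'.map_source hv.2
  differentiableAt v hv := by
    have h1 : ContMDiffOn (𝓡 n) (𝓡 n) r (e' ∘ e.symm) (e.symm.trans e').source := by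
      refine (contMDiffOn_of_mem_maximalAtlas he').comp
        ((contMDiffOn_symm_of_mem_maximalAtlas he).mono ?_) ?_ <;> intro w hw <;>
        simp only [OpenPartialHomeomorph.trans_source] at hw
      exacts [hw.1, hw.2]
    have h0 : r ≠ 0 := by
      rintro rfl
      exact absurd hr (by norm_num)
    exact differentiableAt_of_contDiffOn h1.contDiffOn (e.symm.trans e').open_source hv h0
  eq_position v hv := by
    simp only [OpenPartialHomeomorph.trans_source] at hv
    simp [e'.left_inv hv.2]
  eq_normal v hv := by
    simp only [OpenPartialHomeomorph.trans_source] at hv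
    simp [e'.left_inv hv.2]

/-- The equiaffine normalization of a hypersurface, defined at each point in the preferred
chart there. -/
def equiaffine (x ξ : M → Coord (n + 1)) (p : M) : Coord (n + 1) :=
  normalizationOf (x ∘ (chartAt (Coord n) p).symm) (ξ ∘ (chartAt (Coord n) p).symm)
    (affSupport (x ∘ (chartAt (Coord n) p).symm) (ξ ∘ (chartAt (Coord n) p).symm))
    (chartAt (Coord n) p p)

theorem equiaffine_comp_symm [IsManifold (𝓡 n) r M] (hr : 4 ≤ r) (hx : IsHypersurface r x ξ)
    (he : e ∈ IsManifold.maximalAtlas (𝓡 n) r M) {u : Coord n} (hu : u ∈ e.target) :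
    (equiaffine x ξ ∘ e.symm) u = normalizationOf (x ∘ e.symm) (ξ ∘ e.symm)
      (affSupport (x ∘ e.symm) (ξ ∘ e.symm)) u := by
  have h := hx.isCoordChange hr he (IsManifold.chart_mem_maximalAtlas (e.symm u))
  refine (h.normalizationOf_affSupport_eq ?_).symm
  rw [OpenPartialHomeomorph.trans_source]
  exact ⟨hu, mem_chart_source _ (e.symm u)⟩

theorem isEquiaffine_equiaffine [IsManifold (𝓡 n) r M] (hr : 4 ≤ r)
    (hx : IsHypersurface r x ξ) : IsEquiaffine r x ξ (equiaffine x ξ) where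
  isRelNormalization := by
    refine isRelNormalization_of_isLocalNormalization hr hx fun e he => ?_
    have h := hx.isLocalHypersurface hr he
    have h1 := isLocalNormalization_normalizationOf h (contDiffOn_affSupport h)
      fun v hv => (affSupport_pos h hv).ne'
    have heq := fun v (hv : v ∈ e.target) => equiaffine_comp_symm hr hx he hv
    refine ⟨h1.contDiffOn.congr heq, fun v hv => ?_, fun v hv i => ?_⟩
    · rw [support, heq v hv]
      exact h1.support_ne_zero v hv
    · rw [pd_congr h.isOpen heq hv]
      exact h1.inner_pd v hv i
  support_eq e he u hu := by
    rw [support, equiaffine_comp_symm hr hx he hu,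
      inner_normal_normalizationOf (hx.isLocalHypersurface hr he) hu]

theorem IsEquiaffine.unique [IsManifold (𝓡 n) r M] (hr : 4 ≤ r) (hx : IsHypersurface r x ξ)
    {y y' : M → Coord (n + 1)} (hy : IsEquiaffine r x ξ y) (hy' : IsEquiaffine r x ξ y') :
    y = y' := by
  funext p
  have he : chartAt (Coord n) p ∈ IsManifold.maximalAtlas (𝓡 n) r M :=
    IsManifold.chart_mem_maximalAtlas p
  have := (hy.isRelNormalization.isLocalNormalization hr hx he).eq_of_support_eq
    (hx.isLocalHypersurface hr he) (hy'.isRelNormalization.isLocalNormalization hr hx he)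
    (fun v hv => (hy.support_eq _ he v hv).trans (hy'.support_eq _ he v hv).symm)
    (mem_chart_target _ p)
  simpa using this

end Charts

end RelGeom

end

theorem proposition1 {n : ℕ} (hn : 2 ≤ n) {r : WithTop ℕ∞} (hr : 4 ≤ r)
    {M : Type*} [TopologicalSpace M] [ChartedSpace (RelGeom.Coord n) M] [IsManifold (𝓡 n) r M]
    (x ξ : M → RelGeom.Coord (n + 1)) (hx : RelGeom.IsHypersurface r x ξ) :
    (∃! yA : M → RelGeom.Coord (n + 1), RelGeom.IsEquiaffine r x ξ yA) ∧
    ∀ yA : M → RelGeom.Coord (n + 1), RelGeom.IsEquiaffine r x ξ yA →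
      ∀ e ∈ IsManifold.maximalAtlas (𝓡 n) r M, ∀ u ∈ e.target,
        (∀ y y' : M → RelGeom.Coord (n + 1),
          RelGeom.IsRelNormalization r x y → RelGeom.IsRelNormalization r x y' →
          RelGeom.relFun (x ∘ e.symm) (ξ ∘ e.symm) (y ∘ e.symm) u =
            RelGeom.relFun (x ∘ e.symm) (ξ ∘ e.symm) (y' ∘ e.symm) u) ∧
        ∀ y : M → RelGeom.Coord (n + 1), RelGeom.IsRelNormalization r x y →
          RelGeom.relFun (x ∘ e.symm) (ξ ∘ e.symm) (y ∘ e.symm) u =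
            ((n : ℝ) + 2) * RelGeom.pick (x ∘ e.symm) (ξ ∘ e.symm) (yA ∘ e.symm) u
              / RelGeom.affSupport (x ∘ e.symm) (ξ ∘ e.symm) u ∧
          (RelGeom.relFun (x ∘ e.symm) (ξ ∘ e.symm) (y ∘ e.symm) u = 0 ↔
            RelGeom.pick (x ∘ e.symm) (ξ ∘ e.symm) (yA ∘ e.symm) u = 0) := by
  refine ⟨⟨_, RelGeom.isEquiaffine_equiaffine hr hx, fun y hy =>
    hy.unique hr hx (RelGeom.isEquiaffine_equiaffine hr hx)⟩, fun yA hyA e he u hu => ?_⟩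
  have h := hx.isLocalHypersurface hr he
  have key : ∀ y : M → RelGeom.Coord (n + 1), RelGeom.IsRelNormalization r x y →
      RelGeom.relFun (x ∘ e.symm) (ξ ∘ e.symm) (y ∘ e.symm) u =
        ((n : ℝ) + 2) * RelGeom.pick (x ∘ e.symm) (ξ ∘ e.symm) (yA ∘ e.symm) u
          / RelGeom.affSupport (x ∘ e.symm) (ξ ∘ e.symm) u := fun y hy =>
    RelGeom.relFun_eq_pick h (hy.isLocalNormalization hr hx he)
      (hyA.isRelNormalization.isLocalNormalization hr hx he) (hyA.support_eq e he) hu hn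
  refine ⟨fun y y' hy hy' => (key y hy).trans (key y' hy').symm, fun y hy => ⟨key y hy, ?_⟩⟩
  have hn2 : (n : ℝ) + 2 ≠ 0 := by positivity
  have hq := (RelGeom.affSupport_pos h hu).ne'
  rw [key y hy]
  simp [hn2, hq]
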